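/- Let $G_1$ and $G_2$ be simple graphs (finite or infinite, not necessarily connected) with nonempty disjoint vertex sets, and let $G_1\uplus G_2$ be their join, i.e. the graph with vertex set $V(G_1)\cup V(G_2)$ in which two distinct vertices $u,v$ are adjacent if $uv\in E(G_1)$, or $uv\in E(G_2)$, or one of them lies in $V(G_1)$ and the other in $V(G_2)$. Regard $G_1\uplus G_2$ as a geodesic metric space $X$ by identifying each edge isometrically with $[0,1]$ and taking the shortest-path distance $d$; the points of $X$ are the vertices and all interior points of edges. A geodesic triangle $T$ in $X$ consists of three (not necessarily distinct) points $x_1,x_2,x_3\in X$ and a choice of geodesics $[x_1x_2],[x_2x_3],[x_3x_1]$, its sides; $T$ is $\delta$-thin if every point of each side is at distance at most $\delta$ from the union of the two other sides. Let $\delta(T)=\inf\{\delta\ge 0: T\text{ is }\delta\text{-thin}\}$ and $\delta(X)=\sup_T\delta(T)$, the supremum over all geodesic triangles $T$ in $X$. The space $X$ is hyperbolic if there is a finite $\delta\ge 0$ such that every geodesic triangle in $X$ is $\delta$-thin. Then $G_1\uplus G_2$ is hyperbolic, and $$\delta(G_1\uplus G_2)\in\{0,\tfrac34,1,\tfrac54,\tfrac32\}.$$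 -/

import Mathlib

open scoped ENNReal

/-- The join of two graphs with disjoint vertex sets: the disjoint union of the two graphs together
with all edges between a vertex of the first graph and a vertex of the second one. -/
def SimpleGraph.graphJoin {V W : Type*} (G : SimpleGraph V) (H : SimpleGraph W) :
    SimpleGraph (V ⊕ W) :=
  (G ⊕g H) ⊔ completeBipartiteGraph V W

open Classical in
/-- The points of a graph `G` regarded as a metric graph, in barycentric coordinates: a point is a
vertex (`u = v`), or the point `(1 - t) u + t v` of an edge joining adjacent vertices `u` and `v`,
where `t ∈ [0, 1]`. -/
@[ext]
structure MetricGraph {V : Type*} (G : SimpleGraph V) where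
  /-- the barycentric coordinates of the point -/
  coord : V → ℝ
  exists_eq : ∃ u v : V, (u = v ∨ G.Adj u v) ∧ ∃ t ∈ Set.Icc (0 : ℝ) 1,
    coord = (1 - t) • Pi.single u 1 + t • Pi.single v 1

namespace MetricGraph

variable {V : Type*} {G : SimpleGraph V}

/-- The point `x` lies on the closed edge joining the adjacent vertices `u` and `v`. -/
def OnEdge (x : MetricGraph G) (u v : V) : Prop :=
  G.Adj u v ∧ x.coord u + x.coord v = 1

/-- The distance of a metric graph whose edges have length one: a shortest path from `x` to `y`
either stays inside one edge containing both points, or it leaves through an endpoint `u` of the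
edge (or the vertex) carrying `x`, goes along a shortest path of edges from `u` to an endpoint `v`
of the edge (or the vertex) carrying `y`, and then goes to `y`. The distance is infinite for points
in different connected components. -/
noncomputable instance : EDist (MetricGraph G) where
  edist x y :=
    min (⨅ (u : V) (v : V) (_ : x.OnEdge u v ∧ y.OnEdge u v),
        ENNReal.ofReal |x.coord u - y.coord u|)
      (⨅ (u : V) (v : V) (_ : x.coord u ≠ 0 ∧ y.coord v ≠ 0),
        ENNReal.ofReal (1 - x.coord u) + (G.edist u v : ℝ≥0∞) + ENNReal.ofReal (1 - y.coord v))

theorem edist_def (x y : MetricGraph G) : edist x y =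
    min (⨅ (u : V) (v : V) (_ : x.OnEdge u v ∧ y.OnEdge u v),
        ENNReal.ofReal |x.coord u - y.coord u|)
      (⨅ (u : V) (v : V) (_ : x.coord u ≠ 0 ∧ y.coord v ≠ 0),
        ENNReal.ofReal (1 - x.coord u) + (G.edist u v : ℝ≥0∞) + ENNReal.ofReal (1 - y.coord v)) :=
  rfl

theorem coord_nonneg (x : MetricGraph G) (w : V) : 0 ≤ x.coord w := by
  obtain ⟨u, v, -, t, ht, h⟩ := x.exists_eq
  simp only [h, Pi.add_apply, Pi.smul_apply, Pi.single_apply, smul_eq_mul]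
  split_ifs <;> linarith [ht.1, ht.2]

theorem coord_le_one (x : MetricGraph G) (w : V) : x.coord w ≤ 1 := by
  obtain ⟨u, v, -, t, ht, h⟩ := x.exists_eq
  simp only [h, Pi.add_apply, Pi.smul_apply, Pi.single_apply, smul_eq_mul]
  split_ifs <;> linarith [ht.1, ht.2]

theorem exists_coord_ne_zero (x : MetricGraph G) : ∃ w, x.coord w ≠ 0 := by
  obtain ⟨u, v, -, t, ht, h⟩ := x.exists_eq
  by_contra! hc
  have hu := hc u
  have hv := hc v
  simp only [h, Pi.add_apply, Pi.smul_apply, Pi.single_apply, smul_eq_mul] at hu hv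
  by_cases huv : u = v
  · simp [huv] at hu
  · simp [huv, Ne.symm huv] at hu hv
    linarith

theorem adj_and_add_eq_one (x : MetricGraph G) {a b : V} (hab : a ≠ b) (ha : x.coord a ≠ 0)
    (hb : x.coord b ≠ 0) : G.Adj a b ∧ x.coord a + x.coord b = 1 := by
  obtain ⟨u, v, huv, t, ht, h⟩ := x.exists_eq
  simp only [h, Pi.add_apply, Pi.smul_apply, Pi.single_apply, smul_eq_mul] at ha hb ⊢
  rcases huv with rfl | huv
  · split_ifs at ha hb <;> simp_all
  · have := huv.symm
    split_ifs at ha hb ⊢ <;> simp_all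

theorem coord_eq_zero (x : MetricGraph G) {a b c : V} (hab : a ≠ b) (h1 : x.coord a + x.coord b = 1)
    (hca : c ≠ a) (hcb : c ≠ b) : x.coord c = 0 := by
  by_contra hc
  by_cases ha : x.coord a = 0
  · have := (x.adj_and_add_eq_one hcb hc (by intro h; linarith)).2
    have h3 := lt_of_le_of_ne (x.coord_nonneg c) (Ne.symm hc)
    linarith
  · have := (x.adj_and_add_eq_one hca hc ha).2
    have h3 := lt_of_le_of_ne (x.coord_nonneg c) (Ne.symm hc)
    by_cases hb : x.coord b = 0
    · linarith
    · have := (x.adj_and_add_eq_one hcb hc hb).2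
      have := (x.adj_and_add_eq_one hab ha hb).2
      obtain ⟨u, v, huv, t, ht, h⟩ := x.exists_eq
      simp only [h, Pi.add_apply, Pi.smul_apply, Pi.single_apply, smul_eq_mul] at ha hb hc
      split_ifs at ha hb hc <;> simp_all

theorem coord_eq_zero_of_eq_one (x : MetricGraph G) {a c : V} (h1 : x.coord a = 1) (hca : c ≠ a) :
    x.coord c = 0 := by
  by_contra hc
  have := (x.adj_and_add_eq_one hca hc (by rw [h1]; norm_num)).2
  exact hc (by linarith)

theorem OnEdge.symm {x : MetricGraph G} {u v : V} (h : x.OnEdge u v) : x.OnEdge v u :=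
  ⟨h.1.symm, by rw [add_comm]; exact h.2⟩

theorem edist_le_of_onEdge {x y : MetricGraph G} {u v : V} (hx : x.OnEdge u v) (hy : y.OnEdge u v) :
    edist x y ≤ ENNReal.ofReal |x.coord u - y.coord u| :=
  (min_le_left _ _).trans (iInf_le_of_le u (iInf_le_of_le v (iInf_le_of_le ⟨hx, hy⟩ le_rfl)))

theorem edist_le_of_coord {x y : MetricGraph G} {u v : V} (hx : x.coord u ≠ 0)
    (hy : y.coord v ≠ 0) : edist x y ≤ ENNReal.ofReal (1 - x.coord u) + (G.edist u v : ℝ≥0∞) +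
      ENNReal.ofReal (1 - y.coord v) :=
  (min_le_right _ _).trans (iInf_le_of_le u (iInf_le_of_le v (iInf_le_of_le ⟨hx, hy⟩ le_rfl)))

/-- To bound `edist x y + c` from below it suffices to bound all lengths of paths. -/
theorem le_edist_add {x y : MetricGraph G} {b c : ℝ≥0∞}
    (h1 : ∀ u v, x.OnEdge u v → y.OnEdge u v → b ≤ ENNReal.ofReal |x.coord u - y.coord u| + c)
    (h2 : ∀ u v, x.coord u ≠ 0 → y.coord v ≠ 0 → b ≤ ENNReal.ofReal (1 - x.coord u) +
      (G.edist u v : ℝ≥0∞) + ENNReal.ofReal (1 - y.coord v) + c) : b ≤ edist x y + c := by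
  rw [edist_def, ← min_add_add_right]
  refine le_min ?_ ?_
  · simp only [ENNReal.iInf_add, le_iInf_iff]
    exact fun u v h => h1 u v h.1 h.2
  · simp only [ENNReal.iInf_add, le_iInf_iff]
    exact fun u v h => h2 u v h.1 h.2

theorem edist_self' (x : MetricGraph G) : edist x x = 0 := by
  obtain ⟨u, v, huv, t, ht, h⟩ := x.exists_eq
  rcases huv with rfl | huv
  · have h1 : x.coord u = 1 := by simp [h]
    refine le_antisymm ((edist_le_of_coord (u := u) (v := u) ?_ ?_).trans ?_) zero_le <;>
      simp [h1]
  · have h1 : x.OnEdge u v := ⟨huv, by simp [h, huv.ne, huv.ne']⟩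
    refine le_antisymm ((edist_le_of_onEdge h1 h1).trans ?_) zero_le
    simp

theorem graph_triangle (u v w : V) :
    (G.edist u w : ℝ≥0∞) ≤ (G.edist u v : ℝ≥0∞) + (G.edist v w : ℝ≥0∞) := by
  rw [← ENat.toENNReal_add]
  exact ENat.toENNReal_le.2 SimpleGraph.edist_triangle

theorem edist_comm' (x y : MetricGraph G) : edist x y = edist y x := by
  have key : ∀ x y : MetricGraph G, edist x y ≤ edist y x := by
    intro x y
    rw [← add_zero (edist y x)]
    refine le_edist_add (fun u v hy hx => ?_) (fun u v hy hx => ?_)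
    · rw [add_zero, abs_sub_comm]
      exact edist_le_of_onEdge hx hy
    · refine (edist_le_of_coord hx hy).trans (le_of_eq ?_)
      rw [SimpleGraph.edist_comm]
      ring
  exact le_antisymm (key x y) (key y x)

/-- The distance from a point to a vertex. -/
noncomputable def toVertex (x : MetricGraph G) (w : V) : ℝ≥0∞ :=
  ⨅ (u : V) (_ : x.coord u ≠ 0), ENNReal.ofReal (1 - x.coord u) + (G.edist u w : ℝ≥0∞)

theorem toVertex_le {x : MetricGraph G} {u : V} (hx : x.coord u ≠ 0) (w : V) :
    x.toVertex w ≤ ENNReal.ofReal (1 - x.coord u) + (G.edist u w : ℝ≥0∞) :=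
  iInf_le_of_le u (iInf_le_of_le hx le_rfl)

theorem toVertex_triangle (x : MetricGraph G) (v w : V) :
    x.toVertex w ≤ x.toVertex v + (G.edist v w : ℝ≥0∞) := by
  conv_rhs => rw [toVertex]
  simp only [ENNReal.iInf_add, le_iInf_iff]
  intro u hu
  refine (toVertex_le hu w).trans ?_
  rw [add_assoc]
  gcongr
  exact graph_triangle u v w

theorem edist_le_toVertex_add (x y : MetricGraph G) (w : V) :
    edist x y ≤ x.toVertex w + y.toVertex w := by
  conv_rhs => rw [toVertex, toVertex]
  simp only [ENNReal.iInf_add, ENNReal.add_iInf, le_iInf_iff]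
  intro v hv u hu
  refine (edist_le_of_coord hu hv).trans ?_
  have := graph_triangle (G := G) u w v
  rw [SimpleGraph.edist_comm (u := w)] at this
  calc _ ≤ ENNReal.ofReal (1 - x.coord u) + ((G.edist u w : ℝ≥0∞) + (G.edist v w : ℝ≥0∞)) +
        ENNReal.ofReal (1 - y.coord v) := by gcongr
    _ = _ := by ring

theorem toVertex_le_of_onEdge {x : MetricGraph G} {u v : V} (hx : x.OnEdge u v) :
    x.toVertex u ≤ ENNReal.ofReal (1 - x.coord u) := by
  by_cases hu : x.coord u = 0
  · have hv : x.coord v = 1 := by have := hx.2; linarith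
    refine (toVertex_le (u := v) (by rw [hv]; norm_num) u).trans ?_
    simp [hv, hu, SimpleGraph.edist_eq_one_iff_adj.2 hx.1.symm]
  · refine (toVertex_le hu u).trans ?_
    simp

theorem graph_edist_le (y : MetricGraph G) {a b : V} (ha : y.coord a ≠ 0) (hb : y.coord b ≠ 0) :
    (G.edist a b : ℝ≥0∞) ≤ ENNReal.ofReal (1 - y.coord a) + ENNReal.ofReal (1 - y.coord b) := by
  by_cases hab : a = b
  · simp [hab]
  · obtain ⟨h1, h2⟩ := y.adj_and_add_eq_one hab ha hb
    rw [SimpleGraph.edist_eq_one_iff_adj.2 h1, ← ENNReal.ofReal_add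
      (by linarith [y.coord_le_one a]) (by linarith [y.coord_le_one b])]
    simp only [ENat.toENNReal_one, ENNReal.one_le_ofReal]
    linarith

theorem toVertex_le_edist_add (x y : MetricGraph G) (w : V) :
    x.toVertex w ≤ edist x y + y.toVertex w := by
  refine le_edist_add (fun u v hx hy => ?_) (fun u v hx hy => ?_)
  · conv_rhs => rw [toVertex]
    simp only [ENNReal.add_iInf, le_iInf_iff]
    have key : ∀ u v c, x.OnEdge u v → y.OnEdge u v → c = u →
        x.toVertex w ≤ ENNReal.ofReal |x.coord u - y.coord u| +
          (ENNReal.ofReal (1 - y.coord c) + (G.edist c w : ℝ≥0∞)) := by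
      rintro u v c hx hy rfl
      refine (x.toVertex_triangle c w).trans ?_
      rw [← add_assoc]
      gcongr
      refine (toVertex_le_of_onEdge hx).trans ?_
      rw [← ENNReal.ofReal_add (abs_nonneg _) (by linarith [y.coord_le_one c])]
      refine ENNReal.ofReal_le_ofReal ?_
      linarith [neg_abs_le (x.coord c - y.coord c)]
    intro c hc
    by_cases hcu : c = u
    · exact key u v c hx hy hcu
    by_cases hcv : c = v
    · have := key v u c hx.symm hy.symm hcv
      have h1 : |x.coord v - y.coord v| = |x.coord u - y.coord u| := by
        rw [abs_sub_comm, show y.coord v - x.coord v = x.coord u - y.coord u by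
          linarith [hx.2, hy.2]]
      rwa [h1] at this
    · exact absurd (y.coord_eq_zero hy.1.ne hy.2 hcu hcv) hc
  · conv_rhs => rw [toVertex]
    simp only [ENNReal.add_iInf, le_iInf_iff]
    intro c hc
    calc x.toVertex w ≤ ENNReal.ofReal (1 - x.coord u) + (G.edist u w : ℝ≥0∞) := toVertex_le hx w
      _ ≤ ENNReal.ofReal (1 - x.coord u) + ((G.edist u v : ℝ≥0∞) +
          ((ENNReal.ofReal (1 - y.coord v) + ENNReal.ofReal (1 - y.coord c)) +
            (G.edist c w : ℝ≥0∞))) := by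
        gcongr
        refine (graph_triangle u v w).trans ?_
        gcongr
        refine (graph_triangle v c w).trans ?_
        gcongr
        exact y.graph_edist_le hy hc
      _ = _ := by ring

theorem edist_triangle_of_vertex {x y z : MetricGraph G} {u v u' v' : V} (hx : x.OnEdge u v)
    (hz : z.OnEdge u' v') (h1 : y.coord u = 1)
    (hu : u' = u) :
    edist x z ≤ ENNReal.ofReal |x.coord u - y.coord u| +
      ENNReal.ofReal |y.coord u' - z.coord u'| := by
  subst hu
  refine (edist_le_toVertex_add x z u').trans ?_
  rw [abs_sub_comm, h1, abs_of_nonneg (by linarith [x.coord_le_one u']),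
    abs_of_nonneg (by linarith [z.coord_le_one u'])]
  exact add_le_add (toVertex_le_of_onEdge hx) (toVertex_le_of_onEdge hz)

theorem edist_triangle' (x y z : MetricGraph G) : edist x z ≤ edist x y + edist y z := by
  have swap : ∀ (x y : MetricGraph G) (u v : V), x.OnEdge u v → y.OnEdge u v →
      |x.coord u - y.coord u| = |x.coord v - y.coord v| := by
    intro x y u v hx hy
    rw [abs_sub_comm, show y.coord u - x.coord u = x.coord v - y.coord v by linarith [hx.2, hy.2]]
  refine le_edist_add (fun u v hx hy => ?_) (fun u v hx hy => ?_)
  · rw [add_comm]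
    refine le_edist_add (fun u' v' hy' hz => ?_) (fun u' v' hy' hz => ?_)
    · rw [add_comm]
      by_cases h1 : y.coord u = 1
      · by_cases hu : u' = u
        · exact edist_triangle_of_vertex hx hz h1 hu
        · have h0 := y.coord_eq_zero_of_eq_one h1 hu
          have hv : v' = u := by
            by_contra hv
            have := y.coord_eq_zero_of_eq_one h1 hv
            linarith [hy'.2]
          rw [swap y z u' v' hy' hz]
          exact edist_triangle_of_vertex hx hz.symm h1 hv
      by_cases h2 : y.coord v = 1
      · rw [swap x y u v hx hy]
        by_cases hu : u' = v
        · exact edist_triangle_of_vertex hx.symm hz h2 hu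
        · have h0 := y.coord_eq_zero_of_eq_one h2 hu
          have hv : v' = v := by
            by_contra hv
            have := y.coord_eq_zero_of_eq_one h2 hv
            linarith [hy'.2]
          rw [swap y z u' v' hy' hz]
          exact edist_triangle_of_vertex hx.symm hz.symm h2 hv
      have key : ∀ u' v', y.OnEdge u' v' → z.OnEdge u' v' → u' = u → v' = v →
          edist x z ≤ ENNReal.ofReal |x.coord u - y.coord u| +
            ENNReal.ofReal |y.coord u' - z.coord u'| := by
        rintro _ _ hy' hz rfl rfl
        refine (edist_le_of_onEdge hx hz).trans ?_
        rw [← ENNReal.ofReal_add (abs_nonneg _) (abs_nonneg _)]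
        exact ENNReal.ofReal_le_ofReal (abs_sub_le _ _ _)
      have hmem : ∀ c d, y.OnEdge c d → c = u ∨ c = v := by
        intro c d hcd
        by_contra! hc
        have h0 := y.coord_eq_zero hy.1.ne hy.2 hc.1 hc.2
        have hd : y.coord d = 1 := by linarith [hcd.2]
        by_cases hdu : d = u
        · exact h1 (hdu ▸ hd)
        by_cases hdv : d = v
        · exact h2 (hdv ▸ hd)
        have := y.coord_eq_zero hy.1.ne hy.2 hdu hdv
        linarith
      rcases hmem u' v' hy' with hu | hu <;> rcases hmem v' u' hy'.symm with hv | hv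
      · exact absurd (hu.trans hv.symm) hy'.1.ne
      · exact key u' v' hy' hz hu hv
      · rw [swap y z u' v' hy' hz]
        exact key v' u' hy'.symm hz.symm hv hu
      · exact absurd (hu.trans hv.symm) hy'.1.ne
    · refine (edist_le_toVertex_add x z v').trans ?_
      have h1 : x.toVertex v' ≤ ENNReal.ofReal |x.coord u - y.coord u| +
          (ENNReal.ofReal (1 - y.coord u') + (G.edist u' v' : ℝ≥0∞)) :=
        (x.toVertex_le_edist_add y v').trans
          (add_le_add (edist_le_of_onEdge hx hy) (toVertex_le hy' v'))
      have h2 : z.toVertex v' ≤ ENNReal.ofReal (1 - z.coord v') := by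
        simpa using toVertex_le hz v'
      refine (add_le_add h1 h2).trans (le_of_eq ?_)
      ring
  · refine (edist_le_toVertex_add x z u).trans ?_
    have h1 : z.toVertex u ≤ edist y z + (ENNReal.ofReal (1 - y.coord v) + (G.edist v u : ℝ≥0∞)) :=
      (z.toVertex_le_edist_add y u).trans
        (add_le_add (edist_comm' z y).le (toVertex_le hy u))
    have h2 : x.toVertex u ≤ ENNReal.ofReal (1 - x.coord u) := by
      simpa using toVertex_le hx u
    refine (add_le_add h2 h1).trans (le_of_eq ?_)
    rw [SimpleGraph.edist_comm (u := v)]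
    ring

theorem coord_sub_le_edist (x y : MetricGraph G) (w : V) :
    ENNReal.ofReal |x.coord w - y.coord w| ≤ edist x y := by
  have hle : ∀ a b : MetricGraph G, ∀ w, |a.coord w - b.coord w| ≤ 1 := fun a b w => by
    rw [abs_le]
    constructor <;> linarith [a.coord_le_one w, b.coord_le_one w, a.coord_nonneg w,
      b.coord_nonneg w]
  rw [← add_zero (edist x y)]
  refine le_edist_add (fun u v hx hy => ?_) (fun u v hx hy => ?_)
  · rw [add_zero]
    refine ENNReal.ofReal_le_ofReal ?_
    by_cases hwu : w = u
    · rw [hwu]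
    by_cases hwv : w = v
    · rw [hwv, abs_sub_comm, show y.coord v - x.coord v = x.coord u - y.coord u by
        linarith [hx.2, hy.2]]
    · rw [x.coord_eq_zero hx.1.ne hx.2 hwu hwv, y.coord_eq_zero hy.1.ne hy.2 hwu hwv]
      simp
  · rw [add_zero]
    by_cases huv : u = v
    · subst huv
      rw [SimpleGraph.edist_self, ENat.toENNReal_zero, add_zero, ← ENNReal.ofReal_add
        (by linarith [x.coord_le_one u]) (by linarith [y.coord_le_one u])]
      refine ENNReal.ofReal_le_ofReal ?_
      by_cases hwu : w = u
      · subst hwu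
        rw [abs_le]
        constructor <;> linarith [x.coord_le_one w, y.coord_le_one w]
      · have bound : ∀ a : MetricGraph G, a.coord u ≠ 0 → a.coord w ≤ 1 - a.coord u := by
          intro a ha
          by_cases h0 : a.coord w = 0
          · linarith [a.coord_le_one u]
          · linarith [(a.adj_and_add_eq_one hwu h0 ha).2]
        have := bound x hx
        have := bound y hy
        rw [abs_le]
        constructor <;> linarith [x.coord_nonneg w, y.coord_nonneg w, x.coord_le_one u,
          y.coord_le_one u]
    · have h1 : (1 : ℝ≥0∞) ≤ (G.edist u v : ℝ≥0∞) := by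
        rw [← ENat.toENNReal_one]
        exact ENat.toENNReal_le.2 (Order.one_le_iff_pos.2 (SimpleGraph.edist_pos_of_ne huv))
      calc ENNReal.ofReal |x.coord w - y.coord w| ≤ 1 := by
            rw [← ENNReal.ofReal_one]
            exact ENNReal.ofReal_le_ofReal (hle x y w)
        _ ≤ (G.edist u v : ℝ≥0∞) := h1
        _ ≤ _ := le_add_right le_add_self

noncomputable instance : EMetricSpace (MetricGraph G) where
  edist_self := edist_self'
  edist_comm := edist_comm'
  edist_triangle := edist_triangle'
  eq_of_edist_eq_zero {x y} h := by
    ext w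
    have h1 := x.coord_sub_le_edist y w
    rw [h, nonpos_iff_eq_zero, ENNReal.ofReal_eq_zero] at h1
    exact sub_eq_zero.1 (abs_eq_zero.1 (le_antisymm h1 (abs_nonneg _)))

end MetricGraph

namespace GromovHyperbolic

variable {X : Type*} [EMetricSpace X]

/-- The set `A` is (the image of) a geodesic `[xy]` joining `x` and `y`, parametrized by arc length
on `[0, L]`. -/
def IsGeodesic (A : Set X) (x y : X) : Prop :=
  ∃ (L : ℝ) (γ : ℝ → X), 0 ≤ L ∧
    (∀ s ∈ Set.Icc 0 L, ∀ t ∈ Set.Icc 0 L, edist (γ s) (γ t) = ENNReal.ofReal |s - t|) ∧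
    γ 0 = x ∧ γ L = y ∧ A = γ '' Set.Icc 0 L

/-- `A`, `B`, `C` are the sides `[x₁x₂]`, `[x₂x₃]`, `[x₃x₁]` of a geodesic triangle. Coinciding
corners are allowed. -/
def IsGeodesicTriangle (A B C : Set X) : Prop :=
  ∃ x₁ x₂ x₃ : X, IsGeodesic A x₁ x₂ ∧ IsGeodesic B x₂ x₃ ∧ IsGeodesic C x₃ x₁

/-- Every point of a side is at distance at most `δ` from the union of the two other sides. -/
def IsThin (δ : ℝ≥0∞) (A B C : Set X) : Prop :=
  (∀ p ∈ A, Metric.infEDist p (B ∪ C) ≤ δ) ∧ (∀ p ∈ B, Metric.infEDist p (C ∪ A) ≤ δ) ∧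
    (∀ p ∈ C, Metric.infEDist p (A ∪ B) ≤ δ)

/-- The sharp thin constant of the triangle with sides `A`, `B`, `C`. -/
noncomputable def thinConstant (A B C : Set X) : ℝ≥0∞ :=
  sInf {δ | IsThin δ A B C}

variable (X)

/-- `X` is hyperbolic if, for some finite `δ`, all its geodesic triangles are `δ`-thin. -/
def IsHyperbolic : Prop :=
  ∃ δ : NNReal, ∀ A B C : Set X, IsGeodesicTriangle A B C → IsThin δ A B C

/-- The sharp hyperbolicity constant `δ(X)`: the supremum of the sharp thin constants of all
geodesic triangles. A geodesic triangle lies in one component of an extended metric space, so that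
for a disconnected graph this is the supremum over the connected components. -/
noncomputable def hyperbolicityConstant : ℝ≥0∞ :=
  ⨆ (A : Set X) (B : Set X) (C : Set X) (_ : IsGeodesicTriangle A B C), thinConstant A B C

end GromovHyperbolic

/-! ### Geodesics and thin triangles in an extended metric space. -/

namespace GromovHyperbolic

variable {X : Type*} [EMetricSpace X]

/-! Any two vertices of a join are at distance at most 2. Every point is within 1/2 of a vertex, so
the space has diameter at most 3, and a point of a side is within 3/2 of one end of that side. This
gives hyperbolicity and δ ≤ 3/2 (`infEDist_sides_le`). It remains to exclude the gaps between the
listed values.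

Suppose δ > 5/4. Some p on a side xy is farther than 5/4 from the two other sides, so |xy| > 5/2.
Then x and y lie inside edges whose ends are at mutual distance 2, and there is a vertex m within
1/4 of p joined to the nearer ends of both edges (`exists_middle_vertex`). The other two sides miss
m and all its neighbours. Sliding x and y to the midpoints of their edges gives a side of length 3
with centre m, while the other sides, suitably trimmed, stay at distance 3/2 from m. Hence δ = 3/2
(`three_halves_le_of_avoiding`).

Suppose δ > 1. Then |xy| > 2 for some bad side, which yields a vertex b and an edge uv with both
ends at distance 2 from b (`exists_far_edge`). These three vertices lie in one part of the join. Two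
vertices q, w of the other part close a 5-cycle b q v u w, and a bigon on it shows δ ≥ 5/4. If the
other part is a single vertex w, the bad triangle shows that b and u are connected outside w, and a
walk between them supplies q (`five_quarters_le_of_far_edge`).

Suppose δ ≤ 1. A 4-cycle forces δ ≥ 1. A join without 4-cycles has an apex w, and outside w only
isolated vertices and isolated edges: it is a windmill of triangles and pendant edges glued at w. A
side with a point farther than 3/4 from the others has both ends in one blade, where distances are
at most 3/2, a contradiction. So δ ≤ 3/4, with equality if there is a triangle; otherwise the graph
is a star, a metric tree, and δ = 0.

Two tools recur. Barycentric coordinates are 1-Lipschitz, which turns lower bounds for distances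
into linear inequalities; and they are continuous, so a connected set such as a union of sides can
leave an open edge only through its ends. -/

theorem IsGeodesic.left_mem {A : Set X} {x y : X} (h : IsGeodesic A x y) : x ∈ A := by
  obtain ⟨L, γ, hL, -, h0, -, rfl⟩ := h
  exact ⟨0, ⟨le_rfl, hL⟩, h0⟩

theorem IsGeodesic.right_mem {A : Set X} {x y : X} (h : IsGeodesic A x y) : y ∈ A := by
  obtain ⟨L, γ, hL, -, -, h1, rfl⟩ := h
  exact ⟨L, ⟨hL, le_rfl⟩, h1⟩

theorem IsGeodesic.symm {A : Set X} {x y : X} (h : IsGeodesic A x y) : IsGeodesic A y x := by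
  obtain ⟨L, γ, hL, hγ, h0, h1, rfl⟩ := h
  refine ⟨L, fun t => γ (L - t), hL, fun s hs t ht => ?_, by simpa using h1, by simpa using h0, ?_⟩
  · rw [hγ _ ⟨by linarith [hs.2], by linarith [hs.1]⟩ _ ⟨by linarith [ht.2], by linarith [ht.1]⟩,
      abs_sub_comm]
    congr 2
    ring
  · ext p
    constructor
    · rintro ⟨t, ht, rfl⟩
      exact ⟨L - t, ⟨by linarith [ht.2], by linarith [ht.1]⟩, by simp⟩
    · rintro ⟨t, ht, rfl⟩
      exact ⟨L - t, ⟨by linarith [ht.2], by linarith [ht.1]⟩, rfl⟩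

theorem isGeodesic_singleton (x : X) : IsGeodesic {x} x x := by
  refine ⟨0, fun _ => x, le_rfl, fun s hs t ht => ?_, rfl, rfl, by simp⟩
  have h1 : s = 0 := le_antisymm hs.2 hs.1
  have h2 : t = 0 := le_antisymm ht.2 ht.1
  simp [h1, h2]

/-- A geodesic can be cut at any of its points. -/
theorem IsGeodesic.split {A : Set X} {x y p : X} (h : IsGeodesic A x y) (hp : p ∈ A) :
    ∃ A₁ A₂, A₁ ⊆ A ∧ A₂ ⊆ A ∧ IsGeodesic A₁ x p ∧ IsGeodesic A₂ p y ∧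
      edist x p + edist p y = edist x y := by
  obtain ⟨L, γ, hL, hγ, rfl, rfl, rfl⟩ := h
  obtain ⟨r, hr, rfl⟩ := hp
  refine ⟨γ '' Set.Icc 0 r, γ '' Set.Icc r L, Set.image_mono (Set.Icc_subset_Icc_right hr.2),
    Set.image_mono (Set.Icc_subset_Icc_left hr.1), ⟨r, γ, hr.1, fun s hs t ht =>
      hγ s ⟨hs.1, hs.2.trans hr.2⟩ t ⟨ht.1, ht.2.trans hr.2⟩, rfl, rfl, rfl⟩,
    ⟨L - r, fun t => γ (t + r), by linarith [hr.2], fun s hs t ht => ?_, by simp, by simp, ?_⟩, ?_⟩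
  · rw [hγ _ ⟨by linarith [hs.1, hr.1], by linarith [hs.2]⟩ _
      ⟨by linarith [ht.1, hr.1], by linarith [ht.2]⟩]
    congr 2
    ring
  · ext q
    constructor
    · rintro ⟨t, ht, rfl⟩
      exact ⟨t - r, ⟨by linarith [ht.1], by linarith [ht.2]⟩, by simp⟩
    · rintro ⟨t, ht, rfl⟩
      exact ⟨t + r, ⟨by linarith [ht.1], by linarith [ht.2]⟩, rfl⟩
  · rw [hγ 0 ⟨le_rfl, hL⟩ r hr, hγ r hr L ⟨hL, le_rfl⟩, hγ 0 ⟨le_rfl, hL⟩ L ⟨hL, le_rfl⟩,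
      ← ENNReal.ofReal_add (abs_nonneg _) (abs_nonneg _)]
    congr 1
    rw [abs_of_nonpos (by linarith [hr.1]), abs_of_nonpos (by linarith [hr.2]),
      abs_of_nonpos (by linarith)]
    ring

theorem IsGeodesic.exists_split {A : Set X} {x y p : X}
    (h : IsGeodesic A x y) (hp : p ∈ A) : ∃ A₁ A₂, A₁ ⊆ A ∧ A₂ ⊆ A ∧ IsGeodesic A₁ x p ∧
      IsGeodesic A₂ p y := by
  obtain ⟨A₁, A₂, h1, h2, h3, h4, -⟩ := h.split hp
  exact ⟨A₁, A₂, h1, h2, h3, h4⟩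

/-- Two points of a geodesic are ordered. -/
theorem IsGeodesic.edist_add_or {A : Set X} {x y p q : X} (h : IsGeodesic A x y) (hp : p ∈ A)
    (hq : q ∈ A) :
    edist x p + edist p q = edist x q ∨ edist q p + edist p y = edist q y := by
  obtain ⟨L, γ, hL, hγ, rfl, rfl, rfl⟩ := h
  obtain ⟨s, hs, rfl⟩ := hp
  obtain ⟨t, ht, rfl⟩ := hq
  have h0 : (0 : ℝ) ∈ Set.Icc 0 L := ⟨le_rfl, hL⟩
  have h1 : L ∈ Set.Icc 0 L := ⟨hL, le_rfl⟩
  rcases le_total s t with hst | hst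
  · left
    rw [hγ 0 h0 s hs, hγ s hs t ht, hγ 0 h0 t ht, ← ENNReal.ofReal_add (abs_nonneg _)
      (abs_nonneg _), abs_of_nonpos (by linarith [hs.1]), abs_of_nonpos (by linarith),
      abs_of_nonpos (by linarith [ht.1])]
    congr 1
    ring
  · right
    rw [hγ t ht s hs, hγ s hs L h1, hγ t ht L h1, ← ENNReal.ofReal_add (abs_nonneg _)
      (abs_nonneg _), abs_of_nonpos (by linarith), abs_of_nonpos (by linarith [hs.2]),
      abs_of_nonpos (by linarith [ht.2])]
    congr 1
    ring

/-- Two geodesics whose lengths add up to the distance of their far ends form a geodesic. -/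
theorem IsGeodesic.union {A B : Set X} {x y z : X} (hA : IsGeodesic A x y) (hB : IsGeodesic B y z)
    (h : edist x y + edist y z ≤ edist x z) : IsGeodesic (A ∪ B) x z := by
  obtain ⟨L, γ, hL, hγ, rfl, rfl, rfl⟩ := hA
  obtain ⟨M, η, hM, hη, h0, rfl, rfl⟩ := hB
  have eL : edist (γ 0) (γ L) = ENNReal.ofReal L := by
    rw [hγ 0 ⟨le_rfl, hL⟩ L ⟨hL, le_rfl⟩, zero_sub, abs_neg, abs_of_nonneg hL]
  have eM : edist (γ L) (η M) = ENNReal.ofReal M := by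
    rw [← h0, hη 0 ⟨le_rfl, hM⟩ M ⟨hM, le_rfl⟩, zero_sub, abs_neg, abs_of_nonneg hM]
  rw [eL, eM, ← ENNReal.ofReal_add hL hM] at h
  set ζ : ℝ → X := fun t => if t ≤ L then γ t else η (t - L) with hζ
  have z1 : ∀ t, t ≤ L → ζ t = γ t := fun t ht => by simp [hζ, ht]
  have z2 : ∀ t, L ≤ t → ζ t = η (t - L) := fun t ht => by
    rcases ht.eq_or_lt with rfl | ht
    · simp [hζ, h0]
    · simp [hζ, ht.not_ge]
  have mixed : ∀ s ∈ Set.Icc 0 L, ∀ t ∈ Set.Icc L (L + M),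
      edist (ζ s) (ζ t) = ENNReal.ofReal (t - s) := by
    intro s hs t ht
    rw [z1 s hs.2, z2 t ht.1]
    have ht' : t - L ∈ Set.Icc 0 M := ⟨by linarith [ht.1], by linarith [ht.2]⟩
    have e1 : edist (γ s) (γ L) = ENNReal.ofReal (L - s) := by
      rw [hγ s hs L ⟨hL, le_rfl⟩, abs_of_nonpos (by linarith [hs.2]), neg_sub]
    have e2 : edist (γ L) (η (t - L)) = ENNReal.ofReal (t - L) := by
      rw [← h0, hη 0 ⟨le_rfl, hM⟩ _ ht', zero_sub, abs_neg, abs_of_nonneg ht'.1]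
    have e3 : edist (γ 0) (γ s) = ENNReal.ofReal s := by
      rw [hγ 0 ⟨le_rfl, hL⟩ s hs, zero_sub, abs_neg, abs_of_nonneg hs.1]
    have e4 : edist (η (t - L)) (η M) = ENNReal.ofReal (L + M - t) := by
      rw [hη _ ht' M ⟨hM, le_rfl⟩, abs_of_nonpos (by linarith [ht.2])]
      congr 1
      ring
    refine le_antisymm ?_ ?_
    · refine (edist_triangle _ (γ L) _).trans (le_of_eq ?_)
      rw [e1, e2, ← ENNReal.ofReal_add (by linarith [hs.2]) (by linarith [ht.1])]
      congr 1
      ring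
    -- Lower bound: the ends are L + M apart, and the detour through the two points costs s + d + (L
    -- + M - t), so d ≥ t - s.
    · have h4 := h.trans (edist_triangle4 (γ 0) (γ s) (η (t - L)) (η M))
      rw [e3, e4] at h4
      by_cases htop : edist (γ s) (η (t - L)) = ⊤
      · rw [htop]
        exact le_top
      · have hd : 0 ≤ (edist (γ s) (η (t - L))).toReal := ENNReal.toReal_nonneg
        rw [← ENNReal.ofReal_toReal htop] at h4 ⊢
        rw [← ENNReal.ofReal_add hs.1 hd, ← ENNReal.ofReal_add (by linarith [hs.1])
          (by linarith [ht.2]), ENNReal.ofReal_le_ofReal_iff (by linarith [hs.1, ht.2])] at h4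
        exact ENNReal.ofReal_le_ofReal (by linarith)
  refine ⟨L + M, ζ, by linarith, fun s hs t ht => ?_, z1 0 hL, ?_, ?_⟩
  · rcases le_total s L with hsL | hsL <;> rcases le_total t L with htL | htL
    · rw [z1 s hsL, z1 t htL]
      exact hγ s ⟨hs.1, hsL⟩ t ⟨ht.1, htL⟩
    · rw [mixed s ⟨hs.1, hsL⟩ t ⟨htL, ht.2⟩, abs_sub_comm, abs_of_nonneg (by linarith)]
    · rw [edist_comm, mixed t ⟨ht.1, htL⟩ s ⟨hsL, hs.2⟩, abs_of_nonneg (by linarith)]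
    · rw [z2 s hsL, z2 t htL, hη _ ⟨by linarith, by linarith [hs.2]⟩ _
        ⟨by linarith, by linarith [ht.2]⟩]
      congr 2
      ring
  · rw [z2 _ (by linarith)]
    congr 1
    ring
  · ext q
    constructor
    · rintro (⟨t, ht, rfl⟩ | ⟨t, ht, rfl⟩)
      · exact ⟨t, ⟨ht.1, by linarith [ht.2]⟩, z1 t ht.2⟩
      · refine ⟨L + t, ⟨by linarith [ht.1], by linarith [ht.2]⟩, ?_⟩
        rw [z2 _ (by linarith [ht.1])]
        congr 1
        ring
    · rintro ⟨t, ht, rfl⟩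
      rcases le_total t L with htL | htL
      · exact Or.inl ⟨t, ⟨ht.1, htL⟩, (z1 t htL).symm⟩
      · exact Or.inr ⟨t - L, ⟨by linarith, by linarith [ht.2]⟩, (z2 t htL).symm⟩

theorem IsGeodesic.isPreconnected {A : Set X} {x y : X} (h : IsGeodesic A x y) :
    IsPreconnected A := by
  obtain ⟨L, γ, hL, hγ, -, -, rfl⟩ := h
  refine isPreconnected_Icc.image γ (LipschitzOnWith.continuousOn (K := 1) fun s hs t ht => ?_)
  rw [hγ s hs t ht, ENNReal.coe_one, one_mul, edist_dist, Real.dist_eq]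

theorem isPreconnected_sides {B C : Set X} {x y z : X} (hB : IsGeodesic B y z)
    (hC : IsGeodesic C z x) : IsPreconnected (B ∪ C) :=
  hB.isPreconnected.union z hB.right_mem hC.left_mem hC.isPreconnected

/-- If all points of first sides of triangles are `c`-close to the other sides, so are the points
of all sides. -/
theorem isThin_of_forall {c : ℝ≥0∞}
    (h : ∀ (A B C : Set X) (x y z p : X), IsGeodesic A x y → IsGeodesic B y z → IsGeodesic C z x →
      p ∈ A → Metric.infEDist p (B ∪ C) ≤ c)
    {A B C : Set X} (hT : IsGeodesicTriangle A B C) : IsThin c A B C := by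
  obtain ⟨x, y, z, hA, hB, hC⟩ := hT
  exact ⟨fun p hp => h A B C x y z p hA hB hC hp, fun p hp => h B C A y z x p hB hC hA hp,
    fun p hp => h C A B z x y p hC hA hB hp⟩

theorem hyperbolicityConstant_le {c : ℝ≥0∞}
    (h : ∀ (A B C : Set X) (x y z p : X), IsGeodesic A x y → IsGeodesic B y z → IsGeodesic C z x →
      p ∈ A → Metric.infEDist p (B ∪ C) ≤ c) : hyperbolicityConstant X ≤ c :=
  iSup_le fun _ => iSup_le fun _ => iSup_le fun _ => iSup_le fun hT =>
    sInf_le (isThin_of_forall h hT)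

theorem exists_of_lt_hyperbolicityConstant {c : ℝ≥0∞} (h : c < hyperbolicityConstant X) :
    ∃ (A B C : Set X) (x y z p : X), IsGeodesic A x y ∧ IsGeodesic B y z ∧ IsGeodesic C z x ∧
      p ∈ A ∧ c < Metric.infEDist p (B ∪ C) := by
  by_contra! hc
  exact absurd (hyperbolicityConstant_le fun A B C x y z p hA hB hC hp =>
    hc A B C x y z p hA hB hC hp) (not_le.2 h)

theorem le_hyperbolicityConstant {c : ℝ≥0∞} {A B C : Set X} {x y z p : X} (hA : IsGeodesic A x y)
    (hB : IsGeodesic B y z) (hC : IsGeodesic C z x) (hp : p ∈ A)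
    (h : ∀ q ∈ B ∪ C, c ≤ edist p q) : c ≤ hyperbolicityConstant X := by
  refine le_trans ?_ (le_iSup_of_le A (le_iSup_of_le B (le_iSup_of_le C
    (le_iSup_of_le ⟨x, y, z, hA, hB, hC⟩ le_rfl))))
  exact le_sInf fun δ hδ => (Metric.le_infEDist.2 h).trans (hδ.1 p hp)

/-- A lower bound for the hyperbolicity constant from a geodesic bigon. -/
theorem le_hyperbolicityConstant_of_bigon {c : ℝ≥0∞} {A B : Set X} {x y p : X}
    (hA : IsGeodesic A x y) (hB : IsGeodesic B x y) (hp : p ∈ A) (h : ∀ q ∈ B, c ≤ edist p q) :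
    c ≤ hyperbolicityConstant X := by
  refine le_hyperbolicityConstant hA hB.symm (isGeodesic_singleton x) hp ?_
  rintro q (hq | rfl)
  · exact h q hq
  · exact h _ hB.left_mem

end GromovHyperbolic

namespace MetricGraph

open GromovHyperbolic

variable {V : Type*} {G : SimpleGraph V}

/-! ### Barycentric coordinates: vertices, edges and midpoints. -/

section Coordinates

open Classical in
/-- A vertex as a point of the metric graph. -/
noncomputable def vert (G : SimpleGraph V) (a : V) : MetricGraph G where
  coord := Pi.single a 1
  exists_eq := ⟨a, a, Or.inl rfl, 0, by simp, by simp⟩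

open Classical in
/-- The point `(1 - t) a + t b` of the edge `ab`. -/
noncomputable def edgePoint {a b : V} (h : G.Adj a b) (t : ℝ) (ht : t ∈ Set.Icc (0 : ℝ) 1) :
    MetricGraph G where
  coord := (1 - t) • Pi.single a 1 + t • Pi.single b 1
  exists_eq := ⟨a, b, Or.inr h, t, ht, rfl⟩

@[simp]
theorem vert_coord_self (a : V) : (vert G a).coord a = 1 := by simp [vert]

theorem vert_coord_of_ne {a c : V} (h : c ≠ a) : (vert G a).coord c = 0 := by simp [vert, h]

theorem edgePoint_coord_left {a b : V} (h : G.Adj a b) (t : ℝ) (ht : t ∈ Set.Icc (0 : ℝ) 1) :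
    (edgePoint h t ht).coord a = 1 - t := by simp [edgePoint, h.ne]

theorem edgePoint_coord_right {a b : V} (h : G.Adj a b) (t : ℝ) (ht : t ∈ Set.Icc (0 : ℝ) 1) :
    (edgePoint h t ht).coord b = t := by simp [edgePoint, h.ne']

theorem edgePoint_onEdge {a b : V} (h : G.Adj a b) (t : ℝ) (ht : t ∈ Set.Icc (0 : ℝ) 1) :
    (edgePoint h t ht).OnEdge a b :=
  ⟨h, by rw [edgePoint_coord_left, edgePoint_coord_right]; ring⟩

theorem vert_onEdge {a b : V} (h : G.Adj a b) : (vert G a).OnEdge a b :=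
  ⟨h, by rw [vert_coord_self, vert_coord_of_ne h.ne']; norm_num⟩

theorem eq_vert {x : MetricGraph G} {a : V} (h : x.coord a = 1) : x = vert G a := by
  ext c
  by_cases hc : c = a
  · rw [hc, h, vert_coord_self]
  · rw [x.coord_eq_zero_of_eq_one h hc, vert_coord_of_ne hc]

theorem OnEdge.coord_eq_zero {x : MetricGraph G} {a b c : V} (h : x.OnEdge a b) (hca : c ≠ a)
    (hcb : c ≠ b) : x.coord c = 0 :=
  MetricGraph.coord_eq_zero x h.1.ne h.2 hca hcb

theorem OnEdge.eq_or_eq {x : MetricGraph G} {a b c : V} (h : x.OnEdge a b) (hc : x.coord c ≠ 0) :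
    c = a ∨ c = b := by
  by_contra! h'
  exact hc (h.coord_eq_zero h'.1 h'.2)

theorem OnEdge.ext {x y : MetricGraph G} {a b : V} (hx : x.OnEdge a b) (hy : y.OnEdge a b)
    (h : x.coord a = y.coord a) : x = y := by
  ext c
  by_cases hca : c = a
  · rw [hca, h]
  by_cases hcb : c = b
  · rw [hcb]
    linarith [hx.2, hy.2]
  · rw [hx.coord_eq_zero hca hcb, hy.coord_eq_zero hca hcb]

theorem coord_pos {x : MetricGraph G} {a : V} (h : x.coord a ≠ 0) : 0 < x.coord a :=
  lt_of_le_of_ne (x.coord_nonneg a) h.symm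

/-- A point is a vertex or an interior point of an edge. -/
theorem eq_vert_or_onEdge (x : MetricGraph G) :
    (∃ a, x = vert G a) ∨ ∃ a b, x.OnEdge a b ∧ 0 < x.coord a ∧ 0 < x.coord b := by
  obtain ⟨u, v, huv, t, ht, h⟩ := x.exists_eq
  rcases huv with rfl | huv
  · exact Or.inl ⟨u, eq_vert (by simp [h])⟩
  · have h1 : x.coord u = 1 - t := by simp [h, huv.ne]
    have h2 : x.coord v = t := by simp [h, huv.ne']
    by_cases h0 : t = 0
    · exact Or.inl ⟨u, eq_vert (by rw [h1, h0, sub_zero])⟩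
    by_cases h0' : t = 1
    · exact Or.inl ⟨v, eq_vert (by rw [h2, h0'])⟩
    · refine Or.inr ⟨u, v, ⟨huv, by rw [h1, h2]; ring⟩, ?_, ?_⟩
      · rw [h1]
        exact sub_pos.2 (lt_of_le_of_ne ht.2 h0')
      · rw [h2]
        exact lt_of_le_of_ne ht.1 (Ne.symm h0)

/-- A point with a coordinate strictly between zero and one lies inside an edge. -/
theorem exists_onEdge_of_coord {x : MetricGraph G} {a : V} (h0 : x.coord a ≠ 0)
    (h1 : x.coord a ≠ 1) : ∃ b, x.OnEdge a b ∧ 0 < x.coord b := by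
  rcases x.eq_vert_or_onEdge with ⟨c, rfl⟩ | ⟨c, d, h, hc, hd⟩
  · by_cases hac : a = c
    · exact absurd (by rw [hac, vert_coord_self]) h1
    · exact absurd (vert_coord_of_ne hac) h0
  · rcases h.eq_or_eq h0 with rfl | rfl
    · exact ⟨d, h, hd⟩
    · exact ⟨c, h.symm, hc⟩

theorem eq_vert_or_exists_ne (x : MetricGraph G) (w : V) :
    x = vert G w ∨ ∃ c, c ≠ w ∧ x.coord c ≠ 0 := by
  rcases x.eq_vert_or_onEdge with ⟨c, rfl⟩ | ⟨c, d, h, hc, hd⟩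
  · by_cases hcw : c = w
    · exact Or.inl (by rw [hcw])
    · exact Or.inr ⟨c, hcw, by simp⟩
  · by_cases hcw : c = w
    · exact Or.inr ⟨d, fun h' => h.1.ne (hcw.trans h'.symm), hd.ne'⟩
    · exact Or.inr ⟨c, hcw, hc.ne'⟩

theorem exists_half_le_coord (x : MetricGraph G) : ∃ a, 1 / 2 ≤ x.coord a := by
  rcases x.eq_vert_or_onEdge with ⟨c, rfl⟩ | ⟨c, d, h, -, -⟩
  · exact ⟨c, by rw [vert_coord_self]; norm_num⟩
  · by_cases hc : 1 / 2 ≤ x.coord c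
    · exact ⟨c, hc⟩
    · exact ⟨d, by linarith [h.2]⟩

theorem half_mem_Icc : (1 / 2 : ℝ) ∈ Set.Icc (0 : ℝ) 1 := by norm_num

/-- The midpoint of an edge. -/
noncomputable def midpoint {a b : V} (h : G.Adj a b) : MetricGraph G :=
  edgePoint h (1 / 2) half_mem_Icc

theorem midpoint_onEdge {a b : V} (h : G.Adj a b) : (midpoint h).OnEdge a b :=
  edgePoint_onEdge h _ _

theorem midpoint_coord_left {a b : V} (h : G.Adj a b) : (midpoint h).coord a = 1 / 2 := by
  rw [midpoint, edgePoint_coord_left]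
  norm_num

theorem midpoint_coord_right {a b : V} (h : G.Adj a b) : (midpoint h).coord b = 1 / 2 := by
  rw [midpoint, edgePoint_coord_right]

theorem finite_support_coord (x : MetricGraph G) : {a | x.coord a ≠ 0}.Finite := by
  rcases x.eq_vert_or_onEdge with ⟨c, rfl⟩ | ⟨c, d, h, -, -⟩
  · refine (Set.finite_singleton c).subset fun a ha => ?_
    by_contra hac
    exact ha (vert_coord_of_ne hac)
  · exact (Set.toFinite {c, d}).subset fun a ha => h.eq_or_eq ha

end Coordinates

/-! ### Real-valued distances in graphs whose vertices are within distance two. -/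

section RealDist

/-- The distance of two vertices as a real number. -/
noncomputable def vertexDist (G : SimpleGraph V) (u v : V) : ℝ := (G.edist u v : ℝ≥0∞).toReal

/-- The distance of two points as a real number. -/
noncomputable def realDist (x y : MetricGraph G) : ℝ := (edist x y).toReal

theorem vertexDist_nonneg (u v : V) : 0 ≤ vertexDist G u v := ENNReal.toReal_nonneg

theorem vertexDist_comm (u v : V) : vertexDist G u v = vertexDist G v u := by
  rw [vertexDist, vertexDist, SimpleGraph.edist_comm]

theorem vertexDist_self (u : V) : vertexDist G u u = 0 := by simp [vertexDist]

theorem vertexDist_adj {u v : V} (h : G.Adj u v) : vertexDist G u v = 1 := by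
  simp [vertexDist, SimpleGraph.edist_eq_one_iff_adj.2 h]

theorem realDist_nonneg (x y : MetricGraph G) : 0 ≤ realDist x y := ENNReal.toReal_nonneg

theorem realDist_self (x : MetricGraph G) : realDist x x = 0 := by simp [realDist]

theorem realDist_comm (x y : MetricGraph G) : realDist x y = realDist y x := by
  rw [realDist, realDist, edist_comm]

variable [hG : Fact (∀ u v, G.edist u v ≤ 2)]

/-- The standing `Fact` is the metric content of being a join. It makes all distances finite, so
passing to real numbers by `toReal` loses nothing, and vertex distances are 0, 1 or 2. -/
theorem graph_edist_ne_top (u v : V) : (G.edist u v : ℝ≥0∞) ≠ ⊤ := by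
  have h := hG.out u v
  have h2 : G.edist u v ≠ ⊤ := ne_top_of_le_ne_top (by decide) h
  simpa using h2

theorem ofReal_vertexDist (u v : V) : ENNReal.ofReal (vertexDist G u v) = G.edist u v :=
  ENNReal.ofReal_toReal (graph_edist_ne_top u v)

theorem vertexDist_not_adj {u v : V} (hne : u ≠ v) (h : ¬ G.Adj u v) : vertexDist G u v = 2 := by
  have h1 := hG.out u v
  have h2 : G.edist u v = 2 := by
    refine le_antisymm h1 ?_
    have h3 : (1 : ℕ∞) ≤ G.edist u v :=
      Order.one_le_iff_pos.2 (SimpleGraph.edist_pos_of_ne hne)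
    have h4 : (1 : ℕ∞) ≠ G.edist u v := fun h' => h (SimpleGraph.edist_eq_one_iff_adj.1 h'.symm)
    exact one_add_one_eq_two (R := ℕ∞) ▸ Order.add_one_le_of_lt (lt_of_le_of_ne h3 h4)
  simp [vertexDist, h2]

theorem vertexDist_cases (u v : V) : (u = v ∧ vertexDist G u v = 0) ∨
    (G.Adj u v ∧ vertexDist G u v = 1) ∨ (u ≠ v ∧ ¬ G.Adj u v ∧ vertexDist G u v = 2) := by
  by_cases h : u = v
  · exact Or.inl ⟨h, h ▸ vertexDist_self u⟩
  · by_cases h' : G.Adj u v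
    · exact Or.inr (Or.inl ⟨h', vertexDist_adj h'⟩)
    · exact Or.inr (Or.inr ⟨h, h', vertexDist_not_adj h h'⟩)

theorem vertexDist_le_two (u v : V) : vertexDist G u v ≤ 2 := by
  rcases vertexDist_cases (G := G) u v with ⟨-, h⟩ | ⟨-, h⟩ | ⟨-, -, h⟩ <;> rw [h] <;> norm_num

theorem vertexDist_triangle (u v w : V) :
    vertexDist G u w ≤ vertexDist G u v + vertexDist G v w := by
  rw [vertexDist, vertexDist, vertexDist,
    ← ENNReal.toReal_add (graph_edist_ne_top u v) (graph_edist_ne_top v w)]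
  exact ENNReal.toReal_mono (ENNReal.add_ne_top.2 ⟨graph_edist_ne_top u v, graph_edist_ne_top v w⟩)
    (graph_triangle u v w)

theorem ofReal_path_length (x y : MetricGraph G) (u v : V) :
    ENNReal.ofReal (1 - x.coord u) + (G.edist u v : ℝ≥0∞) + ENNReal.ofReal (1 - y.coord v) =
      ENNReal.ofReal (1 - x.coord u + vertexDist G u v + (1 - y.coord v)) := by
  have h1 := x.coord_le_one u
  have h2 := y.coord_le_one v
  have h3 := vertexDist_nonneg (G := G) u v
  rw [← ofReal_vertexDist, ENNReal.ofReal_add (by linarith) (by linarith),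
    ENNReal.ofReal_add (by linarith) h3]

theorem edist_ne_top (x y : MetricGraph G) : edist x y ≠ ⊤ := by
  obtain ⟨u, hu⟩ := x.exists_coord_ne_zero
  obtain ⟨v, hv⟩ := y.exists_coord_ne_zero
  refine ne_top_of_le_ne_top ?_ (edist_le_of_coord hu hv)
  rw [ofReal_path_length]
  exact ENNReal.ofReal_ne_top

theorem edist_eq_ofReal (x y : MetricGraph G) : edist x y = ENNReal.ofReal (realDist x y) :=
  (ENNReal.ofReal_toReal (edist_ne_top x y)).symm

theorem realDist_triangle (x y z : MetricGraph G) :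
    realDist x z ≤ realDist x y + realDist y z := by
  rw [realDist, realDist, realDist, ← ENNReal.toReal_add (edist_ne_top x y) (edist_ne_top y z)]
  exact ENNReal.toReal_mono (ENNReal.add_ne_top.2 ⟨edist_ne_top x y, edist_ne_top y z⟩)
    (edist_triangle x y z)

theorem edist_add_eq_iff {x y z : MetricGraph G} :
    edist x y + edist y z = edist x z ↔ realDist x y + realDist y z = realDist x z := by
  simp only [edist_eq_ofReal]
  rw [← ENNReal.ofReal_add (realDist_nonneg _ _) (realDist_nonneg _ _),
    ENNReal.ofReal_eq_ofReal_iff (add_nonneg (realDist_nonneg _ _) (realDist_nonneg _ _))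
      (realDist_nonneg _ _)]

theorem realDist_le_of_coord {x y : MetricGraph G} {u v : V} (hx : x.coord u ≠ 0)
    (hy : y.coord v ≠ 0) :
    realDist x y ≤ 1 - x.coord u + vertexDist G u v + (1 - y.coord v) := by
  have h := edist_le_of_coord hx hy
  have h1 := x.coord_le_one u
  have h2 := y.coord_le_one v
  have h3 := vertexDist_nonneg (G := G) u v
  rwa [ofReal_path_length, edist_eq_ofReal, ENNReal.ofReal_le_ofReal_iff (by linarith)] at h

theorem coord_sub_le_realDist (x y : MetricGraph G) (w : V) :
    |x.coord w - y.coord w| ≤ realDist x y := by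
  have h := x.coord_sub_le_edist y w
  rwa [edist_eq_ofReal, ENNReal.ofReal_le_ofReal_iff (realDist_nonneg _ _)] at h

theorem OnEdge.realDist_eq {x y : MetricGraph G} {u v : V} (hx : x.OnEdge u v)
    (hy : y.OnEdge u v) : realDist x y = |x.coord u - y.coord u| := by
  refine le_antisymm ?_ (coord_sub_le_realDist x y u)
  have h := edist_le_of_onEdge hx hy
  rwa [edist_eq_ofReal, ENNReal.ofReal_le_ofReal_iff (abs_nonneg _)] at h

/-- The infimum in the definition of the distance is attained. -/
theorem realDist_cases (x y : MetricGraph G) : (∃ u v, x.OnEdge u v ∧ y.OnEdge u v) ∨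
    ∃ u v, x.coord u ≠ 0 ∧ y.coord v ≠ 0 ∧
      realDist x y = 1 - x.coord u + vertexDist G u v + (1 - y.coord v) := by
  by_cases hE : ∃ u v, x.OnEdge u v ∧ y.OnEdge u v
  · exact Or.inl hE
  right
  push Not at hE
  -- A point has at most two nonzero coordinates, so only finitely many routes compete and a
  -- shortest one exists.
  have hfin := x.finite_support_coord.prod y.finite_support_coord
  have hne : ({a | x.coord a ≠ 0} ×ˢ {a | y.coord a ≠ 0}).Nonempty :=
    Set.Nonempty.prod x.exists_coord_ne_zero y.exists_coord_ne_zero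
  obtain ⟨⟨u, v⟩, ⟨hu, hv⟩, hmin⟩ := Set.exists_min_image _
    (fun c : V × V => 1 - x.coord c.1 + vertexDist G c.1 c.2 + (1 - y.coord c.2)) hfin hne
  refine ⟨u, v, hu, hv, le_antisymm (realDist_le_of_coord hu hv) ?_⟩
  rw [← ENNReal.ofReal_le_ofReal_iff (realDist_nonneg _ _), ← edist_eq_ofReal,
    ← add_zero (edist x y)]
  refine le_edist_add (fun a b ha hb => absurd hb (hE a b ha)) fun a b ha hb => ?_
  rw [ofReal_path_length, add_zero]
  exact ENNReal.ofReal_le_ofReal (hmin (a, b) ⟨ha, hb⟩)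

theorem OnEdge.realDist_vert {x : MetricGraph G} {a b : V} (h : x.OnEdge a b) :
    realDist (vert G a) x = 1 - x.coord a := by
  rw [(vert_onEdge h.1).realDist_eq h, vert_coord_self, abs_of_nonneg]
  linarith [x.coord_le_one a]

theorem OnEdge.realDist_vert' {x : MetricGraph G} {a b : V} (h : x.OnEdge a b) :
    realDist x (vert G a) = 1 - x.coord a := by
  rw [realDist_comm, h.realDist_vert]

theorem one_sub_coord_le_realDist_vert (x : MetricGraph G) (a : V) :
    1 - x.coord a ≤ realDist (vert G a) x := by
  have h := coord_sub_le_realDist (vert G a) x a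
  rw [vert_coord_self] at h
  exact (le_abs_self _).trans h

theorem realDist_vert_of_coord {x : MetricGraph G} {a : V} (h : x.coord a ≠ 0) :
    realDist (vert G a) x = 1 - x.coord a := by
  refine le_antisymm ?_ (x.one_sub_coord_le_realDist_vert a)
  have := realDist_le_of_coord (x := vert G a) (u := a) (by simp) h
  rw [vert_coord_self, vertexDist_self] at this
  linarith

theorem realDist_vert_le {x : MetricGraph G} {a c : V} (h : x.coord c ≠ 0) :
    realDist (vert G a) x ≤ vertexDist G a c + (1 - x.coord c) := by
  have := realDist_le_of_coord (x := vert G a) (u := a) (by simp) h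
  rw [vert_coord_self] at this
  linarith

theorem realDist_vert_vert (a b : V) : realDist (vert G a) (vert G b) = vertexDist G a b := by
  rcases vertexDist_cases (G := G) a b with ⟨rfl, h⟩ | ⟨hab, h⟩ | ⟨hne, hab, h⟩
  · rw [realDist_self, h]
  · rw [(vert_onEdge hab.symm).symm.realDist_vert, vert_coord_of_ne hab.ne, h, sub_zero]
  · rcases realDist_cases (vert G a) (vert G b) with ⟨u, v, h1, h2⟩ | ⟨u, v, hu, hv, h'⟩
    · exfalso
      rcases h1.eq_or_eq (c := a) (by simp) with rfl | rfl <;>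
        rcases h2.eq_or_eq (c := b) (by simp) with rfl | rfl
      · exact hne rfl
      · exact hab h1.1
      · exact hab h1.1.symm
      · exact hne rfl
    · have e1 : u = a := by
        by_contra h0
        exact hu (vert_coord_of_ne h0)
      have e2 : v = b := by
        by_contra h0
        exact hv (vert_coord_of_ne h0)
      subst e1 e2
      rw [h', vert_coord_self, vert_coord_self]
      ring

/-- A path leaving the edge `st` passes through `s` or `t`. -/
theorem OnEdge.le_realDist {p q : MetricGraph G} {s t : V} {r : ℝ} (hp : p.OnEdge s t)
    (hq : ¬ q.OnEdge s t) (hs : r ≤ 1 - p.coord s + realDist (vert G s) q)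
    (ht : r ≤ 1 - p.coord t + realDist (vert G t) q) : r ≤ realDist p q := by
  rcases realDist_cases p q with ⟨u, v, h1, h2⟩ | ⟨u, v, hu, hv, h⟩
  -- A common edge of p and q need not be st when p is one of the ends s, t; then `hs` or `ht` is
  -- already the claim. If p is interior to st, its edge is unique, so q would lie on st.
  · by_cases hps : p.coord s = 1
    · rw [hps] at hs
      rw [eq_vert hps]
      linarith
    by_cases hpt : p.coord t = 1
    · rw [hpt] at ht
      rw [eq_vert hpt]
      linarith
    exfalso
    have hs0 : p.coord s ≠ 0 := fun h0 => hpt (by linarith [hp.2])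
    have ht0 : p.coord t ≠ 0 := fun h0 => hps (by linarith [hp.2])
    rcases h1.eq_or_eq hs0 with rfl | rfl <;> rcases h1.eq_or_eq ht0 with rfl | rfl
    · exact hp.1.ne rfl
    · exact hq h2
    · exact hq h2.symm
    · exact hp.1.ne rfl
  · have h3 := realDist_vert_le (a := u) hv
    rcases hp.eq_or_eq hu with rfl | rfl <;> linarith

end RealDist

/-! ### Geodesics inside an edge and concatenation. -/

section Segments

variable [hG : Fact (∀ u v, G.edist u v ≤ 2)]

/-- The points of the edge `ab` between `x` and `y`. -/
def segment (a b : V) (x y : MetricGraph G) : Set (MetricGraph G) :=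
  {q | q.OnEdge a b ∧ q.coord b ∈ Set.uIcc (x.coord b) (y.coord b)}

theorem isGeodesic_segment {a b : V} {x y : MetricGraph G} (hx : x.OnEdge a b)
    (hy : y.OnEdge a b) : IsGeodesic (segment a b x y) x y := by
  wlog hxy : x.coord b ≤ y.coord b generalizing x y
  · have := (this hy hx (le_of_not_ge hxy)).symm
    rwa [segment, Set.uIcc_comm] at this
  -- The parametrization must be defined on all of ℝ while `edgePoint` needs a parameter in [0, 1].
  -- Clamping changes nothing on the interval in use.
  set c : ℝ → ℝ := fun t => max 0 (min 1 (x.coord b + t)) with hc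
  have hcI : ∀ t, c t ∈ Set.Icc (0 : ℝ) 1 := fun t =>
    ⟨le_max_left _ _, max_le zero_le_one (min_le_left _ _)⟩
  have hceq : ∀ t ∈ Set.Icc 0 (y.coord b - x.coord b), c t = x.coord b + t := fun t ht => by
    have := x.coord_nonneg b
    have := y.coord_le_one b
    rw [hc]
    simp only
    rw [min_eq_right (by linarith [ht.2]), max_eq_right (by linarith [ht.1])]
  have h0 := hceq 0 ⟨le_rfl, by linarith⟩
  have h1 := hceq (y.coord b - x.coord b) ⟨by linarith, le_rfl⟩
  refine ⟨y.coord b - x.coord b, fun t => edgePoint hx.1 (c t) (hcI t), by linarith,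
    fun s hs t ht => ?_, ?_, ?_, ?_⟩
  · rw [edist_eq_ofReal, (edgePoint_onEdge hx.1 _ _).symm.realDist_eq
      (edgePoint_onEdge hx.1 _ _).symm, edgePoint_coord_right, edgePoint_coord_right,
      hceq s hs, hceq t ht]
    congr 2
    ring
  · refine (edgePoint_onEdge hx.1 _ _).symm.ext hx.symm ?_
    rw [edgePoint_coord_right, h0, add_zero]
  · refine (edgePoint_onEdge hx.1 _ _).symm.ext hy.symm ?_
    rw [edgePoint_coord_right, h1]
    ring
  · rw [segment, Set.uIcc_of_le hxy]
    ext q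
    constructor
    · rintro ⟨hq, hq1, hq2⟩
      refine ⟨q.coord b - x.coord b, ⟨by linarith, by linarith⟩, ?_⟩
      refine (edgePoint_onEdge hx.1 _ _).symm.ext hq.symm ?_
      rw [edgePoint_coord_right, hceq _ ⟨by linarith, by linarith⟩]
      ring
    · rintro ⟨t, ht, rfl⟩
      refine ⟨edgePoint_onEdge hx.1 _ _, ?_⟩
      rw [edgePoint_coord_right, hceq t ht]
      constructor <;> linarith [ht.1, ht.2]

theorem isGeodesic_union {A B : Set (MetricGraph G)} {x y z : MetricGraph G}
    (hA : IsGeodesic A x y) (hB : IsGeodesic B y z)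
    (h : realDist x y + realDist y z ≤ realDist x z) : IsGeodesic (A ∪ B) x z :=
  hA.union hB (edist_add_eq_iff.2 (le_antisymm h (realDist_triangle x y z))).le

theorem _root_.GromovHyperbolic.IsGeodesic.realDist_add {A : Set (MetricGraph G)} {x y p : MetricGraph G}
    (h : IsGeodesic A x y) (hp : p ∈ A) : realDist x p + realDist p y = realDist x y := by
  obtain ⟨-, -, -, -, -, -, h⟩ := h.split hp
  exact edist_add_eq_iff.1 h

theorem le_edist_of_le_realDist {x y : MetricGraph G} {r : ℝ} (h : r ≤ realDist x y) :
    ENNReal.ofReal r ≤ edist x y := by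
  rw [edist_eq_ofReal]
  exact ENNReal.ofReal_le_ofReal h

/-- The consequence of a large distance to the other sides of a triangle. -/
theorem lt_realDist_of_lt_infEDist {p q : MetricGraph G} {S : Set (MetricGraph G)} {r : ℝ}
    (h : ENNReal.ofReal r < Metric.infEDist p S) (hq : q ∈ S) : r < realDist p q := by
  have h1 := h.trans_le (Metric.infEDist_le_edist_of_mem hq)
  rw [edist_eq_ofReal] at h1
  exact lt_of_not_ge fun h2 => absurd h1 (not_lt.2 (ENNReal.ofReal_le_ofReal h2))

end Segments

/-! ### Connected sets in a metric graph. -/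

section Topology

theorem continuous_coord (w : V) : Continuous fun x : MetricGraph G => x.coord w := by
  refine LipschitzWith.continuous (K := 1) fun x y => ?_
  rw [ENNReal.coe_one, one_mul, edist_dist, Real.dist_eq]
  exact x.coord_sub_le_edist y w

/-- A connected set that meets the open edge `ab` and its complement contains `a` or `b`. -/
theorem vert_mem_of_isPreconnected {S : Set (MetricGraph G)} (hS : IsPreconnected S)
    {x y : MetricGraph G} {a b : V} (hx : x ∈ S) (hy : y ∈ S) (hE : x.OnEdge a b)
    (ha : 0 < x.coord a) (hb : 0 < x.coord b) (hyE : y.coord a = 0 ∨ y.coord b = 0) :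
    vert G a ∈ S ∨ vert G b ∈ S := by
  by_contra! hc
  -- The open edge and the complement of the closed edge are disjoint open sets that together miss
  -- only the two ends, so without the ends they would disconnect S.
  have h1 : IsOpen {q : MetricGraph G | 0 < q.coord a ∧ 0 < q.coord b} :=
    (isOpen_lt continuous_const (continuous_coord a)).inter
      (isOpen_lt continuous_const (continuous_coord b))
  have h3 : IsOpen {q : MetricGraph G | q.coord a + q.coord b ≠ 1} :=
    isOpen_ne_fun ((continuous_coord a).add (continuous_coord b)) continuous_const
  have hcov : S ⊆ {q : MetricGraph G | 0 < q.coord a ∧ 0 < q.coord b} ∪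
      {q : MetricGraph G | q.coord a + q.coord b ≠ 1} := by
    intro q hq
    by_cases hq0 : q.coord a + q.coord b = 1
    · refine Or.inl ⟨coord_pos fun h0 => hc.2 ?_, coord_pos fun h0 => hc.1 ?_⟩
      · rwa [← eq_vert (x := q) (a := b) (by linarith)]
      · rwa [← eq_vert (x := q) (a := a) (by linarith)]
    · exact Or.inr hq0
  have hy1 : y.coord a + y.coord b ≠ 1 := by
    intro hy1
    rcases hyE with h0 | h0
    · refine hc.2 ?_
      rwa [← eq_vert (x := y) (a := b) (by linarith)]
    · refine hc.1 ?_
      rwa [← eq_vert (x := y) (a := a) (by linarith)]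
  obtain ⟨q, -, hq1, hq2⟩ := hS _ _ h1 h3 hcov ⟨x, hx, ha, hb⟩ ⟨y, hy, hy1⟩
  exact hq2 (q.adj_and_add_eq_one hE.1.ne hq1.1.ne' hq1.2.ne').2

/-- The graph without the edges at the vertex `w`. -/
def isolate (G : SimpleGraph V) (w : V) : SimpleGraph V where
  Adj a b := G.Adj a b ∧ a ≠ w ∧ b ≠ w
  symm := ⟨fun _ _ h => ⟨h.1.symm, h.2.2, h.2.1⟩⟩
  loopless := ⟨fun _ h => h.1.ne rfl⟩

/-- A connected set avoiding the vertex `w` stays in one component of the graph without `w`. -/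
theorem reachable_of_isPreconnected {S : Set (MetricGraph G)} (hS : IsPreconnected S) {w : V}
    (hw : vert G w ∉ S) {x y : MetricGraph G} (hx : x ∈ S) (hy : y ∈ S) {b u : V}
    (hb : x.coord b ≠ 0) (hu : y.coord u ≠ 0) (hbw : b ≠ w) (huw : u ≠ w) :
    (isolate G w).Reachable b u := by
  by_contra hc
  -- Open stars of vertices are open. Away from w, the stars of vertices reachable from b and the
  -- stars of the others cover S; a point in both families would lie on an edge joining the two
  -- classes.
  have hopen : ∀ P : V → Prop, IsOpen {q : MetricGraph G | ∃ c, P c ∧ q.coord c ≠ 0} := by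
    intro P
    have : {q : MetricGraph G | ∃ c, P c ∧ q.coord c ≠ 0} =
        ⋃ c ∈ {c | P c}, {q : MetricGraph G | q.coord c ≠ 0} := by
      ext q
      simp
    rw [this]
    exact isOpen_biUnion fun c _ => isOpen_ne_fun (continuous_coord c) continuous_const
  have hcov : S ⊆ {q : MetricGraph G | ∃ c, (c ≠ w ∧ (isolate G w).Reachable b c) ∧
      q.coord c ≠ 0} ∪ {q : MetricGraph G | ∃ c, (c ≠ w ∧ ¬ (isolate G w).Reachable b c) ∧
      q.coord c ≠ 0} := by
    intro q hq
    obtain ⟨c, hcw, hqc⟩ := (q.eq_vert_or_exists_ne w).resolve_left fun h => hw (h ▸ hq)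
    by_cases hr : (isolate G w).Reachable b c
    · exact Or.inl ⟨c, ⟨hcw, hr⟩, hqc⟩
    · exact Or.inr ⟨c, ⟨hcw, hr⟩, hqc⟩
  obtain ⟨q, -, ⟨c, ⟨hcw, hc1⟩, hqc⟩, d, ⟨hdw, hd1⟩, hqd⟩ := hS _ _ (hopen _) (hopen _) hcov
    ⟨x, hx, b, ⟨hbw, .rfl⟩, hb⟩ ⟨y, hy, u, ⟨huw, hc⟩, hu⟩
  by_cases hcd : c = d
  · exact hd1 (hcd ▸ hc1)
  · exact hd1 (hc1.trans (SimpleGraph.Adj.reachable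
      ⟨(q.adj_and_add_eq_one hcd hqc hqd).1, hcw, hdw⟩))

end Topology

end MetricGraph

/-! ### Lower bounds for the constant from short cycles. -/

namespace MetricGraph

open GromovHyperbolic

variable {V : Type*} {G : SimpleGraph V} [hG : Fact (∀ u v, G.edist u v ≤ 2)]

theorem isGeodesic_initial {a b : V} {y : MetricGraph G} (hy : y.OnEdge a b) :
    IsGeodesic {q : MetricGraph G | q.OnEdge a b ∧ q.coord b ≤ y.coord b} (vert G a) y := by
  convert isGeodesic_segment (vert_onEdge hy.1) hy using 1
  ext q
  rw [segment, vert_coord_of_ne hy.1.ne', Set.uIcc_of_le (y.coord_nonneg b)]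
  exact ⟨fun h => ⟨h.1, q.coord_nonneg b, h.2⟩, fun h => ⟨h.1, h.2.2⟩⟩

theorem isGeodesic_edge {a b : V} (h : G.Adj a b) :
    IsGeodesic {q : MetricGraph G | q.OnEdge a b} (vert G a) (vert G b) := by
  convert isGeodesic_initial (vert_onEdge h.symm).symm using 1
  ext q
  rw [vert_coord_self]
  exact ⟨fun h => ⟨h, q.coord_le_one b⟩, fun h => h.1⟩

theorem realDist_vert_of_adj {a b : V} (h : G.Adj a b) : realDist (vert G a) (vert G b) = 1 := by
  rw [realDist_vert_vert, vertexDist_adj h]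

theorem isGeodesic_edge_union_edge {a b c : V} (hab : G.Adj a b) (hbc : G.Adj b c) (hne : a ≠ c)
    (hac : ¬ G.Adj a c) : IsGeodesic ({q : MetricGraph G | q.OnEdge a b} ∪ {q | q.OnEdge b c})
      (vert G a) (vert G c) := by
  refine isGeodesic_union (isGeodesic_edge hab) (isGeodesic_edge hbc) ?_
  rw [realDist_vert_of_adj hab, realDist_vert_of_adj hbc, realDist_vert_vert,
    vertexDist_not_adj hne hac]
  norm_num

/-- A lower bound for the distance of a point of the edge `st` to a point outside. -/
theorem OnEdge.le_realDist_of_coord {p q : MetricGraph G} {s t : V} {r : ℝ} (hp : p.OnEdge s t)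
    (hq : q.coord s = 0 ∨ q.coord t = 0) (hs : r ≤ 1 - p.coord s + (1 - q.coord s))
    (ht : r ≤ 1 - p.coord t + (1 - q.coord t)) : r ≤ realDist p q := by
  by_cases hqE : q.OnEdge s t
  · rw [hp.realDist_eq hqE]
    have h1 := hp.2
    have h2 := hqE.2
    have h3 := p.coord_le_one s
    have h4 := p.coord_le_one t
    rcases hq with h0 | h0
    · rw [h0, sub_zero, abs_of_nonneg (p.coord_nonneg s)]
      linarith
    · rw [abs_of_nonpos (by linarith)]
      linarith
  · refine hp.le_realDist hqE ?_ ?_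
    · linarith [q.one_sub_coord_le_realDist_vert s]
    · linarith [q.one_sub_coord_le_realDist_vert t]

theorem realDist_vert_midpoint {a b : V} (h : G.Adj a b) :
    realDist (vert G a) (midpoint h) = 1 / 2 := by
  rw [(midpoint_onEdge h).realDist_vert, midpoint_coord_left]
  norm_num

theorem realDist_vert_midpoint' {a b : V} (h : G.Adj a b) :
    realDist (vert G b) (midpoint h) = 1 / 2 := by
  rw [(midpoint_onEdge h).symm.realDist_vert, midpoint_coord_right]
  norm_num

/-- The midpoint of bc is antipodal to a on the 3-cycle, and the two halves of the cycle form a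
bigon of geodesics of length 3/2. The point p is the centre of the half through b. -/
theorem three_quarters_le_of_triangle {a b c : V} (hab : G.Adj a b) (hbc : G.Adj b c)
    (hca : G.Adj c a) :
    ENNReal.ofReal (3 / 4) ≤ hyperbolicityConstant (MetricGraph G) := by
  have hy := midpoint_onEdge hbc
  have hyb := midpoint_coord_left hbc
  have hyc := midpoint_coord_right hbc
  have hay : 3 / 2 ≤ realDist (vert G a) (midpoint hbc) := by
    rw [realDist_comm]
    refine hy.le_realDist_of_coord (Or.inl (vert_coord_of_ne hab.ne')) ?_ ?_
    · rw [hyb, vert_coord_of_ne hab.ne']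
      norm_num
    · rw [hyc, vert_coord_of_ne hca.ne]
      norm_num
  have h34 : (3 / 4 : ℝ) ∈ Set.Icc (0 : ℝ) 1 := by norm_num
  have hp := edgePoint_onEdge hab _ h34
  have hpa := edgePoint_coord_left hab _ h34
  have hpb := edgePoint_coord_right hab _ h34
  refine le_hyperbolicityConstant_of_bigon (p := edgePoint hab _ h34)
    (isGeodesic_union (isGeodesic_edge hab) (isGeodesic_initial hy) ?_)
    (isGeodesic_union (isGeodesic_edge hca.symm) (isGeodesic_initial hy.symm) ?_)
    (Or.inl hp) ?_
  · rw [realDist_vert_of_adj hab, realDist_vert_midpoint]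
    linarith
  · rw [realDist_vert_of_adj hca.symm, realDist_vert_midpoint']
    linarith
  · intro q hq
    refine le_edist_of_le_realDist ?_
    rcases hq with hq | ⟨hq, hq2⟩
    · have h0 := OnEdge.coord_eq_zero hq hab.ne' hbc.ne
      refine hp.le_realDist_of_coord (Or.inr h0) ?_ ?_
      · linarith [q.coord_le_one a]
      · linarith
    · have h0 := hq.coord_eq_zero hca.ne' hab.ne
      refine hp.le_realDist_of_coord (Or.inl h0) ?_ ?_ <;> linarith

/-- The paths a b c and a d c are geodesics, and no point of the second lies on an open edge at b,
so b is at distance 1 from it. -/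
theorem one_le_of_two_paths {a b c d : V} (hab : G.Adj a b) (hbc : G.Adj b c) (hcd : G.Adj c d)
    (hda : G.Adj d a) (hne : a ≠ c) (hac : ¬ G.Adj a c) (hbd : b ≠ d) :
    ENNReal.ofReal 1 ≤ hyperbolicityConstant (MetricGraph G) := by
  refine le_hyperbolicityConstant_of_bigon (p := vert G b)
    (isGeodesic_edge_union_edge hab hbc hne hac)
    (isGeodesic_edge_union_edge hda.symm hcd.symm hne hac) (Or.inr (vert_onEdge hbc)) ?_
  intro q hq
  refine le_edist_of_le_realDist ?_
  have h0 : q.coord b = 0 := by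
    rcases hq with hq | hq
    · exact OnEdge.coord_eq_zero hq hab.ne' hbd
    · exact OnEdge.coord_eq_zero hq hbd hbc.ne
  linarith [q.one_sub_coord_le_realDist_vert b]

/-- With both diagonals present, opposite vertices of a 4-cycle are too close to be used. Midpoints
of the disjoint edges ab and cd are at distance 2, and the routes along ac and along bd form the
bigon; the centre of the first is the midpoint of ac. -/
theorem one_le_of_complete {a b c d : V} (hab : G.Adj a b) (hbc : G.Adj b c) (hcd : G.Adj c d)
    (hda : G.Adj d a) (hac : G.Adj a c) (hbd : G.Adj b d) :
    ENNReal.ofReal 1 ≤ hyperbolicityConstant (MetricGraph G) := by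
  have hx := midpoint_onEdge hab
  have hxa := midpoint_coord_left hab
  have hxb := midpoint_coord_right hab
  have hy := midpoint_onEdge hcd
  have hyc := midpoint_coord_left hcd
  have hyd := midpoint_coord_right hcd
  have hxy : 2 ≤ realDist (midpoint hab) (midpoint hcd) := by
    have h0 : ¬ (midpoint hcd).OnEdge a b := fun h => by
      have := hy.coord_eq_zero hac.ne hda.ne'
      have := hy.coord_eq_zero hbc.ne hbd.ne
      linarith [h.2]
    have key : ∀ e, e ≠ c → e ≠ d → 3 / 2 ≤ realDist (vert G e) (midpoint hcd) := by
      intro e hec hed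
      rw [realDist_comm]
      refine hy.le_realDist_of_coord (Or.inl (vert_coord_of_ne hec.symm)) ?_ ?_
      · rw [hyc, vert_coord_of_ne hec.symm]
        norm_num
      · rw [hyd, vert_coord_of_ne hed.symm]
        norm_num
    refine hx.le_realDist h0 ?_ ?_
    · linarith [key a hac.ne hda.ne']
    · linarith [key b hbc.ne hbd.ne]
  have path : ∀ e f, ∀ (hxe : realDist (midpoint hab) (vert G e) = 1 / 2)
      (hyf : realDist (vert G f) (midpoint hcd) = 1 / 2) (hef : G.Adj e f)
      {A B : Set (MetricGraph G)}, IsGeodesic A (midpoint hab) (vert G e) →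
      IsGeodesic B (vert G f) (midpoint hcd) → IsGeodesic (A ∪ {q | q.OnEdge e f} ∪ B)
        (midpoint hab) (midpoint hcd) := by
    intro e f hxe hyf hef A B hA hB
    have h1 := realDist_vert_of_adj hef
    have h2 := realDist_triangle (midpoint hab) (vert G f) (midpoint hcd)
    have h3 := realDist_triangle (midpoint hab) (vert G e) (vert G f)
    refine isGeodesic_union (isGeodesic_union hA (isGeodesic_edge hef) ?_) hB ?_ <;> linarith
  have hp := midpoint_onEdge hac
  have hpa := midpoint_coord_left hac
  have hpc := midpoint_coord_right hac
  refine le_hyperbolicityConstant_of_bigon (p := midpoint hac)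
    (path a c ?_ (realDist_vert_midpoint hcd) hac (isGeodesic_initial hx).symm
      (isGeodesic_initial hy))
    (path b d ?_ (realDist_vert_midpoint' hcd) hbd (isGeodesic_initial hx.symm).symm
      (isGeodesic_initial hy.symm))
    (Or.inl (Or.inr hp)) ?_
  · rw [realDist_comm, realDist_vert_midpoint]
  · rw [realDist_comm, realDist_vert_midpoint']
  · intro q hq
    refine le_edist_of_le_realDist ?_
    rcases hq with (⟨hq, hq2⟩ | hq) | ⟨hq, hq2⟩
    · have h0 := hq.coord_eq_zero hbc.ne' hac.ne'
      refine hp.le_realDist_of_coord (Or.inr h0) ?_ ?_ <;> linarith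
    · have h0 := OnEdge.coord_eq_zero hq hab.ne hda.ne'
      have h1 := OnEdge.coord_eq_zero hq hbc.ne' hcd.ne
      refine hp.le_realDist_of_coord (Or.inl h0) ?_ ?_ <;> linarith
    · have h0 := hq.coord_eq_zero hda.ne' hac.ne
      refine hp.le_realDist_of_coord (Or.inl h0) ?_ ?_ <;> linarith

theorem one_le_of_four_cycle {a b c d : V} (hab : G.Adj a b) (hbc : G.Adj b c) (hcd : G.Adj c d)
    (hda : G.Adj d a) (hac : a ≠ c) (hbd : b ≠ d) :
    ENNReal.ofReal 1 ≤ hyperbolicityConstant (MetricGraph G) := by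
  by_cases h1 : G.Adj a c
  · by_cases h2 : G.Adj b d
    · exact one_le_of_complete hab hbc hcd hda h1 h2
    · exact one_le_of_two_paths hbc hcd hda hab hbd h2 hac.symm
  · exact one_le_of_two_paths hab hbc hcd hda hac h1 hbd

/-- The bigon joins b to the midpoint of vu, at distance 5/2, through q, v and through w, u. Its
test point is the centre of the first path, 1/4 beyond q. Leaving it through q costs 1/4 + 1, and
through v it costs 3/4 + 1/2, since the other path covers only the half of vu next to u. The chords
qu and vw do no harm. -/
theorem five_quarters_le_of_five_cycle {b q v u w : V} (hbq : G.Adj b q) (hqv : G.Adj q v)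
    (hvu : G.Adj v u) (huw : G.Adj u w) (hwb : G.Adj w b) (hbv : b ≠ v) (hbv' : ¬ G.Adj b v)
    (hbu : b ≠ u) (hbu' : ¬ G.Adj b u) (hqw : q ≠ w) :
    ENNReal.ofReal (5 / 4) ≤ hyperbolicityConstant (MetricGraph G) := by
  have hqu : q ≠ u := fun h => hbu' (h ▸ hbq)
  have hvw : v ≠ w := fun h => hbv' (h ▸ hwb.symm)
  have hy := midpoint_onEdge hvu
  have hyv := midpoint_coord_left hvu
  have hyu := midpoint_coord_right hvu
  have hby : 5 / 2 ≤ realDist (vert G b) (midpoint hvu) := by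
    rw [realDist_comm]
    refine hy.le_realDist ?_ ?_ ?_
    · intro h
      linarith [h.2, vert_coord_of_ne (G := G) hbv.symm, vert_coord_of_ne (G := G) hbu.symm]
    · rw [realDist_vert_vert, vertexDist_not_adj hbv.symm (fun h => hbv' h.symm)]
      linarith
    · rw [realDist_vert_vert, vertexDist_not_adj hbu.symm (fun h => hbu' h.symm)]
      linarith
  have h14 : (1 / 4 : ℝ) ∈ Set.Icc (0 : ℝ) 1 := by norm_num
  have hp := edgePoint_onEdge hqv _ h14
  have hpq := edgePoint_coord_left hqv _ h14
  have hpv := edgePoint_coord_right hqv _ h14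
  refine le_hyperbolicityConstant_of_bigon (p := edgePoint hqv _ h14)
    (isGeodesic_union (isGeodesic_edge_union_edge hbq hqv hbv hbv') (isGeodesic_initial hy) ?_)
    (isGeodesic_union (isGeodesic_edge_union_edge hwb.symm huw.symm hbu hbu')
      (isGeodesic_initial hy.symm) ?_) (Or.inl (Or.inr hp)) ?_
  · rw [realDist_vert_vert, vertexDist_not_adj hbv hbv', realDist_vert_midpoint]
    linarith
  · rw [realDist_vert_vert, vertexDist_not_adj hbu hbu', realDist_vert_midpoint']
    linarith
  · intro r hr
    refine le_edist_of_le_realDist ?_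
    have h0 : r.coord q = 0 := by
      rcases hr with (hr | hr) | ⟨hr, -⟩
      · exact OnEdge.coord_eq_zero hr hbq.ne' hqw
      · exact OnEdge.coord_eq_zero hr hqw hqu
      · exact hr.coord_eq_zero hqu hqv.ne
    have h1 : r.coord v ≤ 1 / 2 := by
      rcases hr with (hr | hr) | ⟨hr, hr2⟩
      · rw [OnEdge.coord_eq_zero hr hbv.symm hvw]
        norm_num
      · rw [OnEdge.coord_eq_zero hr hvw hvu.ne]
        norm_num
      · linarith
    refine hp.le_realDist_of_coord (Or.inl h0) ?_ ?_ <;> linarith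

end MetricGraph

/-! ### The upper bound 3/2 and the gap between 5/4 and 3/2. -/

namespace MetricGraph

open GromovHyperbolic

variable {V : Type*} {G : SimpleGraph V} [hG : Fact (∀ u v, G.edist u v ≤ 2)]

theorem realDist_le_three (x y : MetricGraph G) : realDist x y ≤ 3 := by
  obtain ⟨a, ha⟩ := x.exists_half_le_coord
  obtain ⟨b, hb⟩ := y.exists_half_le_coord
  have h := realDist_le_of_coord (x := x) (y := y) (u := a) (v := b)
    (fun h => by rw [h] at ha; norm_num at ha) (fun h => by rw [h] at hb; norm_num at hb)
  linarith [vertexDist_le_two (G := G) a b]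

/-- The ends of the side belong to the other two sides, and the side has length at most 3, so its
nearer end is within 3/2 of p. -/
theorem infEDist_sides_le {A B C : Set (MetricGraph G)} {x y z p : MetricGraph G}
    (hA : IsGeodesic A x y) (hB : IsGeodesic B y z) (hC : IsGeodesic C z x) (hp : p ∈ A) :
    Metric.infEDist p (B ∪ C) ≤ ENNReal.ofReal (3 / 2) := by
  by_contra! h
  have h1 := lt_realDist_of_lt_infEDist h (Or.inl hB.left_mem)
  have h2 := lt_realDist_of_lt_infEDist h (Or.inr hC.right_mem)
  have h3 := hA.realDist_add hp
  rw [realDist_comm p x] at h2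
  linarith [realDist_le_three x y]

/-- A geodesic avoiding the vertex `e` can be close to `e` only at its ends. -/
theorem coord_eq_zero_of_isGeodesic {A : Set (MetricGraph G)} {g h : MetricGraph G} {e : V}
    (hA : IsGeodesic A g h) (he : vert G e ∉ A) (hg : g.coord e = 0) (hh : h.coord e = 0)
    {q : MetricGraph G} (hq : q ∈ A) : q.coord e = 0 := by
  by_contra hqe
  obtain ⟨f, hf, hf0⟩ := exists_onEdge_of_coord hqe fun h1 => he (by rwa [← eq_vert h1])
  obtain ⟨A₁, A₂, h1, h2, hA1, hA2⟩ := hA.exists_split hq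
  -- A point q inside the edge ef could only be entered and left through f, since e is avoided. The
  -- geodesic would then visit f both before and after q, which is impossible as q ≠ f.
  have hf1 : vert G f ∈ A₁ := (vert_mem_of_isPreconnected hA1.isPreconnected hA1.right_mem
    hA1.left_mem hf (coord_pos hqe) hf0 (Or.inl hg)).resolve_left fun h' => he (h1 h')
  have hf2 : vert G f ∈ A₂ := (vert_mem_of_isPreconnected hA2.isPreconnected hA2.left_mem
    hA2.right_mem hf (coord_pos hqe) hf0 (Or.inl hh)).resolve_left fun h' => he (h2 h')
  have e1 := hA1.realDist_add hf1
  have e2 := hA2.realDist_add hf2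
  have e3 := hA.realDist_add hq
  have e4 := realDist_triangle g (vert G f) h
  have e5 := q.one_sub_coord_le_realDist_vert f
  rw [realDist_comm q] at e2
  linarith [coord_pos hqe, hf.2]

/-- A geodesic that starts inside the edge `ab`, ends at `z`, and avoids all vertices of `E ∋ a`
passes through `b`, up to its end inside the edge containing `z`. -/
theorem exists_geodesic_from_vert {E : Set V} {B : Set (MetricGraph G)} {x z f : MetricGraph G}
    {a b : V} (hB : IsGeodesic B x z) (hE : ∀ e ∈ E, vert G e ∉ B) (hx : x.OnEdge a b)
    (ha0 : 0 < x.coord a) (hb0 : 0 < x.coord b) (ha : a ∈ E) (hb : b ∉ E)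
    (hf : (f = z ∧ ∀ e ∈ E, z.coord e = 0) ∨ ∃ e ∈ E, ∃ c ∉ E, z.OnEdge e c ∧ 0 < z.coord e ∧
      0 < z.coord c ∧ f = vert G c) :
    realDist x (vert G b) + realDist (vert G b) f = realDist x f ∧
      ∃ B', IsGeodesic B' (vert G b) f ∧ ∀ q ∈ B', ∀ e ∈ E, q.coord e = 0 := by
  have hvb : ∀ e ∈ E, (vert G b).coord e = 0 := fun e he =>
    vert_coord_of_ne fun h => hb (h ▸ he)
  have hmem : z.coord a = 0 ∨ z.coord b = 0 → vert G b ∈ B := fun h =>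
    (vert_mem_of_isPreconnected hB.isPreconnected hB.left_mem hB.right_mem hx ha0 hb0
      h).resolve_left (hE a ha)
  rcases hf with ⟨rfl, hz⟩ | ⟨e, he, c, hc, hz, he0, hc0, rfl⟩
  · have hbB := hmem (Or.inl (hz a ha))
    obtain ⟨B₁, B₂, -, h2, -, hB2⟩ := hB.exists_split hbB
    exact ⟨hB.realDist_add hbB, B₂, hB2, fun q hq e he =>
      coord_eq_zero_of_isGeodesic hB2 (fun h => hE e he (h2 h)) (hvb e he) (hz e he) hq⟩
  · by_cases hzab : z.coord a = 0 ∨ z.coord b = 0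
    · have hbB := hmem hzab
      obtain ⟨B₁, B₂, -, h2, -, hB2⟩ := hB.exists_split hbB
      have hcB : vert G c ∈ B₂ := (vert_mem_of_isPreconnected hB2.isPreconnected hB2.right_mem
        hB2.left_mem hz he0 hc0 (Or.inl (hvb e he))).resolve_left fun h => hE e he (h2 h)
      obtain ⟨B₃, B₄, h3, -, hB3, -⟩ := hB2.exists_split hcB
      have e1 := hB.realDist_add hbB
      have e2 := hB2.realDist_add hcB
      have e3 := realDist_triangle x (vert G c) z
      have e4 := realDist_triangle x (vert G b) (vert G c)
      refine ⟨by linarith, B₃, hB3, fun q hq d hd => ?_⟩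
      exact coord_eq_zero_of_isGeodesic hB3 (fun h => hE d hd (h2 (h3 h))) (hvb d hd)
        (vert_coord_of_ne fun h => hc (h ▸ hd)) hq
    -- Here z lies inside the edge ab itself. Then f is b and the remaining geodesic is a single
    -- point.
    · push Not at hzab
      have hbc : b = c := by
        rcases hz.eq_or_eq hzab.2 with h | h
        · exact absurd (h ▸ he) hb
        · exact h
      subst hbc
      refine ⟨by rw [realDist_self, add_zero], {vert G b}, isGeodesic_singleton _, ?_⟩
      rintro q rfl
      exact hvb

theorem two_le_realDist_vert {m : V} {q : MetricGraph G}
    (hq : ∀ e, (e = m ∨ G.Adj m e) → q.coord e = 0) : 2 ≤ realDist (vert G m) q := by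
  rcases realDist_cases (vert G m) q with ⟨u, v, h1, h2⟩ | ⟨u, v, hu, hv, h⟩
  · exfalso
    have h3 := h2.2
    rcases h1.eq_or_eq (c := m) (by simp) with rfl | rfl
    · linarith [hq m (Or.inl rfl), hq v (Or.inr h1.1)]
    · linarith [hq m (Or.inl rfl), hq u (Or.inr h1.1.symm)]
  · have hum : u = m := by
      by_contra h0
      exact hu (vert_coord_of_ne h0)
    subst hum
    have hv' : ¬ (v = u ∨ G.Adj u v) := fun h' => hv (hq v h')
    push Not at hv'
    rw [h, vert_coord_self, vertexDist_not_adj (Ne.symm hv'.1) hv'.2]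
    linarith [q.coord_le_one v]

/-- Since `x.coord b ≤ 1 / 2`, the midpoint of ab lies between x and b, so a geodesic from x through
b can be started there instead. The half edge it keeps is at distance at least 3/2 from m, because
the way to m through a costs 1/2 + 1; from b onwards it avoids the open stars of m and its
neighbours and so stays at distance 2. -/
theorem exists_geodesic_from_midpoint {B : Set (MetricGraph G)} {x z f : MetricGraph G}
    {a b m : V} (hB : IsGeodesic B x z) (hE : ∀ e, (e = m ∨ G.Adj m e) → vert G e ∉ B)
    (hx : x.OnEdge a b) (hb0 : 0 < x.coord b) (hb1 : x.coord b ≤ 1 / 2)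
    (hma : G.Adj m a) (hbm : b ≠ m) (hmb : ¬ G.Adj m b)
    (hf : (f = z ∧ ∀ e, (e = m ∨ G.Adj m e) → z.coord e = 0) ∨ ∃ e, (e = m ∨ G.Adj m e) ∧
      ∃ c, ¬ (c = m ∨ G.Adj m c) ∧ z.OnEdge e c ∧ 0 < z.coord e ∧ 0 < z.coord c ∧
        f = vert G c) :
    ∃ B', IsGeodesic B' (midpoint hx.1) f ∧ ∀ q ∈ B', 3 / 2 ≤ realDist (vert G m) q := by
  have hM := midpoint_onEdge hx.1
  have hMa := midpoint_coord_left hx.1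
  have hMb := midpoint_coord_right hx.1
  obtain ⟨h1, B', hB', h2⟩ := exists_geodesic_from_vert (E := {e | e = m ∨ G.Adj m e}) (f := f)
    hB hE hx (by linarith [hx.2]) hb0 (Or.inr hma) (by rintro (h | h); exacts [hbm h, hmb h]) hf
  have h3 := realDist_triangle x (midpoint hx.1) f
  rw [hx.realDist_eq hM, hMa, abs_of_nonneg (by linarith [hx.2])] at h3
  rw [hx.symm.realDist_vert'] at h1
  refine ⟨_, isGeodesic_union (isGeodesic_initial hM.symm).symm hB' ?_, ?_⟩
  · rw [hM.symm.realDist_vert', hMb]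
    linarith [hx.2]
  · rintro q (⟨hq, hq2⟩ | hq)
    · rw [realDist_comm]
      refine hq.symm.le_realDist ?_ ?_ ?_
      · intro h
        linarith [h.2, vert_coord_of_ne (G := G) hma.ne', vert_coord_of_ne (G := G) hbm]
      · rw [realDist_vert_of_adj hma.symm]
        linarith
      · rw [realDist_vert_vert, vertexDist_not_adj hbm fun h => hmb h.symm]
        linarith [q.coord_le_one b]
    · linarith [two_le_realDist_vert (h2 q hq)]

/-- The new triangle has corners at the midpoints of ab and uv and at a point f near z. Its first
side runs through a, m, u and has length 3 because all ends of the two edges are at mutual distance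
2; m is its centre. The other two sides come from B and C by `exists_geodesic_from_midpoint`. -/
theorem three_halves_le_of_avoiding {B C : Set (MetricGraph G)} {x y z : MetricGraph G}
    {a b u v m : V} (hB : IsGeodesic B y z) (hC : IsGeodesic C z x)
    (hE : ∀ e, (e = m ∨ G.Adj m e) → vert G e ∉ B ∪ C)
    (hx : x.OnEdge a b) (hb0 : 0 < x.coord b) (hb1 : x.coord b ≤ 1 / 2)
    (hy : y.OnEdge u v) (hv0 : 0 < y.coord v) (hv1 : y.coord v ≤ 1 / 2)
    (hma : G.Adj m a) (hmu : G.Adj m u)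
    (hdist : ∀ c ∈ ({a, b} : Set V), ∀ g ∈ ({u, v} : Set V), vertexDist G c g = 2) :
    ENNReal.ofReal (3 / 2) ≤ hyperbolicityConstant (MetricGraph G) := by
  have hau := hdist a (by simp) u (by simp)
  have hav := hdist a (by simp) v (by simp)
  have hbu := hdist b (by simp) u (by simp)
  have hbv := hdist b (by simp) v (by simp)
  have hne : ∀ c g, vertexDist G c g = 2 → c ≠ g := by
    rintro c g h rfl
    rw [vertexDist_self] at h
    norm_num at h
  have hS := isPreconnected_sides hB hC
  have hxS : x ∈ B ∪ C := Or.inr hC.right_mem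
  have hyS : y ∈ B ∪ C := Or.inl hB.left_mem
  have hzS : z ∈ B ∪ C := Or.inl hB.right_mem
  have hbS : vert G b ∈ B ∪ C := (vert_mem_of_isPreconnected hS hxS hyS hx (by linarith [hx.2]) hb0
    (Or.inl (hy.coord_eq_zero (hne _ _ hau) (hne _ _ hav)))).resolve_left (hE a (Or.inr hma))
  have hvS : vert G v ∈ B ∪ C := (vert_mem_of_isPreconnected hS hyS hxS hy (by linarith [hy.2]) hv0
    (Or.inl (hx.coord_eq_zero (hne _ _ hau).symm (hne _ _ hbu).symm))).resolve_left
      (hE u (Or.inr hmu))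
  have hbE : ¬ (b = m ∨ G.Adj m b) := fun h => hE b h hbS
  have hvE : ¬ (v = m ∨ G.Adj m v) := fun h => hE v h hvS
  -- The corner z serves unless it lies inside an edge ec with e in the closed neighbourhood of m;
  -- then it is moved to c. This c is outside the neighbourhood, since otherwise the connected set B
  -- ∪ C would miss both ends and be trapped in that edge, away from x.
  obtain ⟨f, hf⟩ : ∃ f, (f = z ∧ ∀ e, (e = m ∨ G.Adj m e) → z.coord e = 0) ∨
      ∃ e, (e = m ∨ G.Adj m e) ∧ ∃ c, ¬ (c = m ∨ G.Adj m c) ∧ z.OnEdge e c ∧ 0 < z.coord e ∧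
        0 < z.coord c ∧ f = vert G c := by
    by_cases hz : ∀ e, (e = m ∨ G.Adj m e) → z.coord e = 0
    · exact ⟨z, Or.inl ⟨rfl, hz⟩⟩
    · push Not at hz
      obtain ⟨e, he, hze⟩ := hz
      obtain ⟨c, hc, hc0⟩ := exists_onEdge_of_coord hze fun h1 => hE e he (by rwa [← eq_vert h1])
      refine ⟨vert G c, Or.inr ⟨e, he, c, fun hcE => ?_, hc, coord_pos hze, hc0, rfl⟩⟩
      have hbe : b ≠ e := fun h => hbE (h ▸ he)
      have hbc : b ≠ c := fun h => hbE (h ▸ hcE)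
      have := hc.1.ne
      have h0 : x.coord e = 0 ∨ x.coord c = 0 := by
        by_contra! h0
        rcases hx.eq_or_eq h0.1 with h | h
        · rcases hx.eq_or_eq h0.2 with h' | h'
          · exact this (h.trans h'.symm)
          · exact hbc h'.symm
        · exact hbe h.symm
      rcases vert_mem_of_isPreconnected hS hzS hxS hc (coord_pos hze) hc0 h0 with h | h
      · exact hE e he h
      · exact hE c hcE h
  push Not at hbE hvE
  obtain ⟨C', hC', hC2⟩ := exists_geodesic_from_midpoint hC.symm
    (fun e he h => hE e he (Or.inr h)) hx hb0 hb1 hma hbE.1 hbE.2 hf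
  obtain ⟨B', hB', hB2⟩ := exists_geodesic_from_midpoint hB
    (fun e he h => hE e he (Or.inl h)) hy hv0 hv1 hmu hvE.1 hvE.2 hf
  have hX := midpoint_onEdge hx.1
  have hXa := midpoint_coord_left hx.1
  have hXb := midpoint_coord_right hx.1
  have hY := midpoint_onEdge hy.1
  have hYu := midpoint_coord_left hy.1
  have hYv := midpoint_coord_right hy.1
  have hXY : 3 ≤ realDist (midpoint hx.1) (midpoint hy.1) := by
    have key : ∀ c, vertexDist G c u = 2 → vertexDist G c v = 2 →
        5 / 2 ≤ realDist (vert G c) (midpoint hy.1) := by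
      intro c hcu hcv
      rw [realDist_comm]
      refine hY.le_realDist ?_ ?_ ?_
      · intro h
        linarith [h.2, vert_coord_of_ne (G := G) (hne _ _ hcu).symm,
          vert_coord_of_ne (G := G) (hne _ _ hcv).symm]
      · rw [realDist_vert_vert, vertexDist_comm, hcu]
        linarith
      · rw [realDist_vert_vert, vertexDist_comm, hcv]
        linarith
    refine hX.le_realDist ?_ ?_ ?_
    · intro h
      linarith [h.2, hY.coord_eq_zero (hne _ _ hau) (hne _ _ hav),
        hY.coord_eq_zero (hne _ _ hbu) (hne _ _ hbv)]
    · linarith [key a hau hav]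
    · linarith [key b hbu hbv]
  have d1 := hX.realDist_vert'
  have d2 := hY.realDist_vert
  have d3 := realDist_vert_of_adj hma.symm
  have d4 := realDist_vert_of_adj hmu
  have d5 := realDist_triangle (midpoint hx.1) (vert G u) (midpoint hy.1)
  have d6 := realDist_triangle (midpoint hx.1) (vert G m) (vert G u)
  have d7 := realDist_triangle (midpoint hx.1) (vert G a) (vert G m)
  refine le_hyperbolicityConstant (p := vert G m)
    (isGeodesic_union (isGeodesic_union (isGeodesic_union (isGeodesic_initial hX).symm
      (isGeodesic_edge hma.symm) ?_) (isGeodesic_edge hmu) ?_) (isGeodesic_initial hY) ?_)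
    hB' hC'.symm (Or.inl (Or.inl (Or.inr (vert_onEdge hma).symm))) ?_
  · linarith
  · linarith
  · linarith
  · rintro q (hq | hq)
    · exact le_edist_of_le_realDist (hB2 q hq)
    · exact le_edist_of_le_realDist (hC2 q hq)

/-- A vertex is within 2 + 1/2 of any point. For ends c, g of the two edges, the routes through c, g
and through the opposite ends d, k have total length 2 + d(c, g) + d(d, k); both exceed 5/2, so d(c,
g) > 1. -/
theorem of_five_halves_lt_realDist {x y : MetricGraph G} (h : 5 / 2 < realDist x y) :
    (∀ c, x.coord c ≠ 1) ∧ ∀ c g, x.coord c ≠ 0 → y.coord g ≠ 0 → vertexDist G c g = 2 := by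
  have key : ∀ x y : MetricGraph G, 5 / 2 < realDist x y → ∀ c, x.coord c ≠ 1 := by
    intro x y h c hc
    obtain ⟨g, hg⟩ := y.exists_half_le_coord
    have := realDist_le_of_coord (x := x) (y := y) (u := c) (v := g)
      (by rw [hc]; norm_num) (by linarith)
    linarith [vertexDist_le_two (G := G) c g]
  refine ⟨key x y h, fun c g hc hg => ?_⟩
  obtain ⟨d, hd, hd0⟩ := exists_onEdge_of_coord hc (key x y h c)
  obtain ⟨k, hk, hk0⟩ := exists_onEdge_of_coord hg (key y x (by rwa [realDist_comm]) g)
  have h1 := realDist_le_of_coord hc hg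
  have h2 := realDist_le_of_coord hd0.ne' hk0.ne'
  have h3 := vertexDist_le_two (G := G) d k
  have h4 := hd.2
  have h5 := hk.2
  rcases vertexDist_cases (G := G) c g with ⟨-, h6⟩ | ⟨-, h6⟩ | ⟨-, -, h6⟩
  · linarith
  · linarith
  · exact h6

/-- The vertex in the middle of a long geodesic. -/
theorem exists_middle_vertex {x y p : MetricGraph G} (h : 5 / 2 < realDist x y)
    (hp : realDist x p + realDist p y = realDist x y) (hxp : 5 / 4 < realDist x p)
    (hpy : 5 / 4 < realDist p y) :
    ∃ a b u v m, x.OnEdge a b ∧ 0 < x.coord b ∧ x.coord b ≤ 1 / 2 ∧ y.OnEdge u v ∧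
      0 < y.coord v ∧ y.coord v ≤ 1 / 2 ∧ G.Adj m a ∧ G.Adj m u ∧
      realDist p (vert G m) < 1 / 4 := by
  obtain ⟨hx1, hdist⟩ := of_five_halves_lt_realDist h
  have hy1 := (of_five_halves_lt_realDist (x := y) (y := x) (by rwa [realDist_comm])).1
  have close : ∀ q r : MetricGraph G, 5 / 4 < realDist q r →
      ¬ ∃ u v, q.OnEdge u v ∧ r.OnEdge u v := by
    rintro q r hqr ⟨u, v, h1, h2⟩
    rw [h1.realDist_eq h2] at hqr
    have : |q.coord u - r.coord u| ≤ 1 := abs_le.2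
      ⟨by linarith [q.coord_nonneg u, r.coord_le_one u],
        by linarith [r.coord_nonneg u, q.coord_le_one u]⟩
    linarith
  obtain ⟨c, e, hc, he, h1⟩ := (realDist_cases x p).resolve_left (close x p hxp)
  obtain ⟨e', g, he', hg, h2⟩ := (realDist_cases p y).resolve_left (close p y hpy)
  obtain ⟨d, hd, hd0⟩ := exists_onEdge_of_coord hc (hx1 c)
  obtain ⟨k, hk, hk0⟩ := exists_onEdge_of_coord hg (hy1 g)
  have hcg := hdist c g hc hg
  have l1 := realDist_le_of_coord hc hg
  have l2 := realDist_le_of_coord hd0.ne' hg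
  have l3 := realDist_le_of_coord hc hk0.ne'
  rw [hcg] at l1
  rw [hdist d g hd0.ne' hg] at l2
  rw [hdist c k hc hk0.ne'] at l3
  have hd2 := hd.2
  have hk2 := hk.2
  have t1 := vertexDist_triangle (G := G) c e g
  have t2 := vertexDist_triangle (G := G) e e' g
  have hc0 := x.coord_nonneg c
  have hg0 := y.coord_nonneg g
  have he1 := p.coord_le_one e
  have he1' := p.coord_le_one e'
  have fin : ∀ m, G.Adj m c → G.Adj m g → realDist p (vert G m) < 1 / 4 →
      1 / 2 ≤ x.coord c → 1 / 2 ≤ y.coord g →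
      ∃ a b u v m, x.OnEdge a b ∧ 0 < x.coord b ∧ x.coord b ≤ 1 / 2 ∧ y.OnEdge u v ∧
      0 < y.coord v ∧ y.coord v ≤ 1 / 2 ∧ G.Adj m a ∧ G.Adj m u ∧
      realDist p (vert G m) < 1 / 4 := fun m h1 h2 h3 h4 h5 =>
    ⟨c, d, g, k, m, hd, hd0, by linarith, hk, hk0, by linarith, h1, h2, h3⟩
  -- Between c and g the geodesic has length 2. If it enters and leaves p by the same vertex, then p
  -- is that vertex and m = p. Otherwise p is on the edge ee', which takes up length 1, so one of c
  -- = e, e' = g holds and m is the end of ee' that is neither c nor g. Comparison with routes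
  -- through d and k gives `1 / 2 ≤ x.coord c` and `1 / 2 ≤ y.coord g`, whence p is within 5/4 - 1
  -- of m.
  by_cases hee : e = e'
  · subst hee
    have hpe : p.coord e = 1 := by linarith
    have hpm : realDist p (vert G e) < 1 / 4 := by
      rw [realDist_comm, realDist_vert_of_coord he, hpe]
      norm_num
    rcases vertexDist_cases (G := G) c e with ⟨-, h6⟩ | ⟨h5, h6⟩ | ⟨-, -, h6⟩ <;>
      rcases vertexDist_cases (G := G) e g with ⟨-, h8⟩ | ⟨h7, h8⟩ | ⟨-, -, h8⟩ <;>
      first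
      | exact fin e h5.symm h7 hpm (by linarith) (by linarith)
      | (exfalso; linarith)
  · obtain ⟨hadj, hsum⟩ := p.adj_and_add_eq_one hee he he'
    have h9 := vertexDist_adj hadj
    have hpm : realDist p (vert G e) = 1 - p.coord e := by
      rw [realDist_comm, realDist_vert_of_coord he]
    have hpm' : realDist p (vert G e') = 1 - p.coord e' := by
      rw [realDist_comm, realDist_vert_of_coord he']
    rcases vertexDist_cases (G := G) c e with ⟨h5, h6⟩ | ⟨h5, h6⟩ | ⟨-, -, h6⟩ <;>
      rcases vertexDist_cases (G := G) e' g with ⟨h7, h8⟩ | ⟨h7, h8⟩ | ⟨-, -, h8⟩ <;>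
      first
      | (exfalso; linarith)
      | (refine fin e' ?_ h7 (by linarith) (by linarith) (by linarith); rw [h5]; exact hadj.symm)
      | (refine fin e h5.symm ?_ (by linarith) (by linarith) (by linarith); rw [← h7]; exact hadj)

/-- The vertex m is within 1/4 of p, so m and its neighbours are within 5/4 of p and cannot lie on
the other two sides. -/
theorem three_halves_le_of_five_quarters_lt
    (h : ENNReal.ofReal (5 / 4) < hyperbolicityConstant (MetricGraph G)) :
    ENNReal.ofReal (3 / 2) ≤ hyperbolicityConstant (MetricGraph G) := by
  obtain ⟨A, B, C, x, y, z, p, hA, hB, hC, hp, hlt⟩ := exists_of_lt_hyperbolicityConstant h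
  have far : ∀ q ∈ B ∪ C, 5 / 4 < realDist p q := fun q hq => lt_realDist_of_lt_infEDist hlt hq
  have hpy := far y (Or.inl hB.left_mem)
  have hpx := far x (Or.inr hC.right_mem)
  rw [realDist_comm] at hpx
  have hadd := hA.realDist_add hp
  have hL : 5 / 2 < realDist x y := by linarith
  obtain ⟨a, b, u, v, m, hx, hb0, hb1, hy, hv0, hv1, hma, hmu, hpm⟩ :=
    exists_middle_vertex hL hadd hpx hpy
  have hdist := (of_five_halves_lt_realDist hL).2
  have ha0 : x.coord a ≠ 0 := fun h0 => by linarith [hx.2]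
  have hu0 : y.coord u ≠ 0 := fun h0 => by linarith [hy.2]
  refine three_halves_le_of_avoiding hB hC ?_ hx hb0 hb1 hy hv0 hv1 hma hmu ?_
  · intro e he hmem
    have h1 := far _ hmem
    have h2 := realDist_triangle p (vert G m) (vert G e)
    rcases he with rfl | he
    · linarith
    · linarith [realDist_vert_of_adj he]
  · rintro c (rfl | rfl) g (rfl | rfl)
    · exact hdist _ _ ha0 hu0
    · exact hdist _ _ ha0 hv0.ne'
    · exact hdist _ _ hb0.ne' hu0
    · exact hdist _ _ hb0.ne' hv0.ne'

end MetricGraph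

/-! ### Graphs with an apex: windmills and stars. -/

namespace MetricGraph

open GromovHyperbolic

variable {V : Type*} {G : SimpleGraph V}

theorem eq_of_reachable_isolate {w : V} (hstar : ∀ a b, a ≠ w → b ≠ w → ¬ G.Adj a b) {b u : V}
    (h : (isolate G w).Reachable b u) : b = u := by
  obtain ⟨p⟩ := h
  cases p with
  | nil => rfl
  | cons h _ => exact absurd h.1 (hstar _ _ h.2.1 h.2.2)

theorem onEdge_of_star {w : V} (hw : ∀ v, v ≠ w → G.Adj w v)
    (hstar : ∀ a b, a ≠ w → b ≠ w → ¬ G.Adj a b) {q : MetricGraph G} {e : V} (he : e ≠ w)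
    (hq : q.coord e ≠ 0) : q.OnEdge e w := by
  by_cases h1 : q.coord e = 1
  · rw [eq_vert h1]
    exact vert_onEdge (hw e he).symm
  · obtain ⟨b, h, -⟩ := exists_onEdge_of_coord hq h1
    by_cases hb : b = w
    · exact hb ▸ h
    · exact absurd h.1 (hstar _ _ he hb)

variable [hG : Fact (∀ u v, G.edist u v ≤ 2)]

theorem realDist_vert_apex_le {w : V} (hw : ∀ v, v ≠ w → G.Adj w v) (q : MetricGraph G) :
    realDist (vert G w) q ≤ 3 / 2 := by
  obtain ⟨a, ha⟩ := q.exists_half_le_coord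
  have h := realDist_vert_le (a := w) (x := q) (c := a) (by linarith)
  by_cases haw : a = w
  · rw [haw, vertexDist_self] at h
    rw [haw] at ha
    linarith
  · rw [vertexDist_adj (hw a haw)] at h
    linarith

/-- In a triangle that is not `3 / 4`-thin, the ends of a side are connected outside an apex. -/
theorem reachable_of_far_sides {A B C : Set (MetricGraph G)} {x y z p : MetricGraph G} {w : V}
    (hw : ∀ v, v ≠ w → G.Adj w v) (hA : IsGeodesic A x y) (hB : IsGeodesic B y z)
    (hC : IsGeodesic C z x) (hp : p ∈ A) (hfar : ∀ q ∈ B ∪ C, 3 / 4 < realDist p q) {b u : V}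
    (hb : x.coord b ≠ 0) (hu : y.coord u ≠ 0) (hbw : b ≠ w) (huw : u ≠ w) :
    (isolate G w).Reachable b u := by
  have hx : x ∈ B ∪ C := Or.inr hC.right_mem
  have hy : y ∈ B ∪ C := Or.inl hB.left_mem
  by_cases h1 : vert G w ∈ B ∪ C
  -- If w were on A too, p would lie between w and one of x, y, and that end would be farther than
  -- 3/4 + 3/4 from w. Every point is within 3/2 of an apex, so A avoids w and itself connects x to
  -- y.
  · refine reachable_of_isPreconnected hA.isPreconnected (fun h2 => ?_) hA.left_mem hA.right_mem
      hb hu hbw huw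
    have f1 := hfar _ h1
    rcases hA.edist_add_or hp h2 with h | h
    · rw [edist_add_eq_iff] at h
      have f2 := hfar x hx
      have := realDist_vert_apex_le hw x
      rw [realDist_comm p x] at f2
      rw [realDist_comm x (vert G w)] at h
      linarith
    · rw [edist_add_eq_iff] at h
      have f2 := hfar y hy
      have := realDist_vert_apex_le hw y
      rw [realDist_comm p (vert G w)] at f1
      linarith
  · exact reachable_of_isPreconnected (isPreconnected_sides hB hC) h1 hx hy hb hu hbw huw

section Windmill

/-- The routes from x to y through c and through i, j have total length at most the perimeter 3, so
the shorter is at most 3/2. -/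
theorem realDist_le_of_triangle {x y : MetricGraph G} {c i j : V} (hx : x.OnEdge c i)
    (hy : y.OnEdge c j) (hij : i = j ∨ G.Adj i j) : realDist x y ≤ 3 / 2 := by
  have h1 := realDist_triangle x (vert G c) y
  have h2 := realDist_triangle x (vert G i) y
  have h3 := realDist_triangle (vert G i) (vert G j) y
  have h4 : realDist (vert G i) (vert G j) ≤ 1 := by
    rcases hij with rfl | hij
    · rw [realDist_self]
      norm_num
    · rw [realDist_vert_of_adj hij]
  rw [hx.realDist_vert', hy.realDist_vert] at h1
  rw [hx.symm.realDist_vert'] at h2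
  rw [hy.symm.realDist_vert] at h3
  linarith [hx.2, hy.2]

/-- By `hm`, components outside w have at most two vertices, so connected points lie in one blade: a
triangle through w or a pendant edge. If x or y is w itself, the bound is that for the apex. -/
theorem realDist_le_of_windmill {x y : MetricGraph G} {w : V} (hw : ∀ v, v ≠ w → G.Adj w v)
    (hm : ∀ a b c, a ≠ w → b ≠ w → c ≠ w → a ≠ c → G.Adj a b → ¬ G.Adj b c)
    (hr : ∀ b u, x.coord b ≠ 0 → y.coord u ≠ 0 → b ≠ w → u ≠ w → (isolate G w).Reachable b u) :
    realDist x y ≤ 3 / 2 := by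
  have near : ∀ b u, (isolate G w).Reachable b u → b = u ∨ G.Adj b u := by
    rintro b u ⟨p⟩
    induction p with
    | nil => exact Or.inl rfl
    | @cons b c u h p ih =>
      rcases ih with rfl | ih
      · exact Or.inr h.1
      · by_cases huw : u = w
        · exact Or.inr (huw ▸ (hw b h.2.1).symm)
        · by_contra! hbu
          exact hm b c u h.2.1 h.2.2 huw hbu.1 h.1 ih
  have place : ∀ (q : MetricGraph G) b, b ≠ w → q.coord b ≠ 0 →
      q.OnEdge b w ∨ ∃ b', b' ≠ w ∧ q.OnEdge b b' := by
    intro q b hbw hb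
    by_cases h1 : q.coord b = 1
    · left
      rw [eq_vert h1]
      exact vert_onEdge (hw b hbw).symm
    · obtain ⟨b', h, -⟩ := exists_onEdge_of_coord hb h1
      by_cases hb' : b' = w
      · exact Or.inl (hb' ▸ h)
      · exact Or.inr ⟨b', hb', h⟩
  rcases x.eq_vert_or_exists_ne w with rfl | ⟨b, hbw, hb⟩
  · exact realDist_vert_apex_le hw y
  rcases y.eq_vert_or_exists_ne w with rfl | ⟨u, huw, hu⟩
  · rw [realDist_comm]
    exact realDist_vert_apex_le hw x
  -- A vertex has at most one neighbour other than w, so the edges carrying x and y fit into a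
  -- single triangle.
  have mate : ∀ b c d, b ≠ w → c ≠ w → d ≠ w → G.Adj b c → G.Adj b d → c = d := by
    intro b c d hb hc hd hbc hbd
    by_contra hcd
    exact hm c b d hc hb hd hcd hbc.symm hbd
  rcases near b u (hr b u hb hu hbw huw) with rfl | hbu
  · rcases place x b hbw hb with hx | ⟨b', hb', hx⟩ <;>
      rcases place y b huw hu with hy | ⟨u', hu', hy⟩
    · exact realDist_le_of_triangle hx hy (Or.inl rfl)
    · exact realDist_le_of_triangle hx hy (Or.inr (hw u' hu'))
    · exact realDist_le_of_triangle hx hy (Or.inr (hw b' hb').symm)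
    · exact realDist_le_of_triangle hx hy (Or.inl (mate b b' u' hbw hb' hu' hx.1 hy.1))
  · rcases place x b hbw hb with hx | ⟨b', hb', hx⟩ <;>
      rcases place y u huw hu with hy | ⟨u', hu', hy⟩
    · exact realDist_le_of_triangle hx.symm hy.symm (Or.inr hbu)
    · obtain rfl := mate u u' b huw hu' hbw hy.1 hbu.symm
      exact realDist_le_of_triangle hx hy.symm (Or.inr (hw u huw))
    · obtain rfl := mate b b' u hbw hb' huw hx.1 hbu
      exact realDist_le_of_triangle hx.symm hy (Or.inr (hw b hbw).symm)
    · obtain rfl := mate b b' u hbw hb' huw hx.1 hbu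
      obtain rfl := mate b' u' b huw hu' hbw hy.1 hbu.symm
      exact realDist_le_of_triangle hx hy.symm (Or.inl rfl)

theorem hyperbolicityConstant_le_of_windmill {w : V} (hw : ∀ v, v ≠ w → G.Adj w v)
    (hm : ∀ a b c, a ≠ w → b ≠ w → c ≠ w → a ≠ c → G.Adj a b → ¬ G.Adj b c) :
    hyperbolicityConstant (MetricGraph G) ≤ ENNReal.ofReal (3 / 4) := by
  refine hyperbolicityConstant_le fun A B C x y z p hA hB hC hp => ?_
  by_contra! h
  have hfar : ∀ q ∈ B ∪ C, 3 / 4 < realDist p q := fun q hq => lt_realDist_of_lt_infEDist h hq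
  have h1 := realDist_le_of_windmill hw hm fun b u hb hu hbw huw =>
    reachable_of_far_sides hw hA hB hC hp hfar hb hu hbw huw
  have h2 := hfar x (Or.inr hC.right_mem)
  have h3 := hfar y (Or.inl hB.left_mem)
  rw [realDist_comm p x] at h2
  linarith [hA.realDist_add hp]

end Windmill

section Star

/-- A star is a metric tree, so a connected set containing both ends of a geodesic contains the
whole geodesic. -/
theorem mem_sides_of_star {w : V} (hw : ∀ v, v ≠ w → G.Adj w v)
    (hstar : ∀ a b, a ≠ w → b ≠ w → ¬ G.Adj a b) {A S : Set (MetricGraph G)}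
    {x y p : MetricGraph G} (hA : IsGeodesic A x y) (hS : IsPreconnected S) (hx : x ∈ S)
    (hy : y ∈ S) (hp : p ∈ A) : p ∈ S := by
  by_contra hpS
  have hadd := hA.realDist_add hp
  rcases p.eq_vert_or_exists_ne w with rfl | ⟨e, hew, hpe⟩
  · obtain ⟨b, hbw, hb⟩ := (x.eq_vert_or_exists_ne w).resolve_left fun h => hpS (h ▸ hx)
    obtain ⟨u, huw, hu⟩ := (y.eq_vert_or_exists_ne w).resolve_left fun h => hpS (h ▸ hy)
    obtain rfl := eq_of_reachable_isolate hstar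
      (reachable_of_isPreconnected hS hpS hx hy hb hu hbw huw)
    have hxE := onEdge_of_star hw hstar hbw hb
    have hyE := onEdge_of_star hw hstar hbw hu
    rw [hxE.realDist_eq hyE, hxE.symm.realDist_vert', hyE.symm.realDist_vert] at hadd
    have h1 := hxE.2
    have h2 := hyE.2
    rcases abs_cases (x.coord b - y.coord b) with ⟨h3, -⟩ | ⟨h3, -⟩ <;>
      linarith [coord_pos hb, coord_pos hu]
  · have hpE := onEdge_of_star hw hstar hew hpe
    have hp0 := coord_pos hpe
    -- On a star, a nonzero coordinate at the leaf e determines the point. As S misses p, the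
    -- connected image of S misses the value at p, so x and y lie on the same side of p, which
    -- contradicts p being between them.
    have hne : ∀ q ∈ S, q.coord e ≠ p.coord e := fun q hq h =>
      hpS (hpE.ext (onEdge_of_star hw hstar hew (by rwa [h])) h.symm ▸ hq)
    have himg := hS.image _ (continuous_coord e).continuousOn
    have side : (x.coord e < p.coord e ∧ y.coord e < p.coord e) ∨
        (p.coord e < x.coord e ∧ p.coord e < y.coord e) := by
      have conv := himg.ordConnected
      rcases lt_or_gt_of_ne (hne x hx) with h1 | h1 <;> rcases lt_or_gt_of_ne (hne y hy) with h2 | h2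
      · exact Or.inl ⟨h1, h2⟩
      · obtain ⟨q, hq, h⟩ := conv.out ⟨x, hx, rfl⟩ ⟨y, hy, rfl⟩ ⟨h1.le, h2.le⟩
        exact absurd h (hne q hq)
      · obtain ⟨q, hq, h⟩ := conv.out ⟨y, hy, rfl⟩ ⟨x, hx, rfl⟩ ⟨h2.le, h1.le⟩
        exact absurd h (hne q hq)
      · exact Or.inr ⟨h1, h2⟩
    rcases side with ⟨h1, h2⟩ | ⟨h1, h2⟩
    -- Both ends are on the side of w: either q is on the leg of e between w and p, or its route to
    -- p runs through w. In each combination the detour through p is strictly longer than d(x, y).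
    · have key : ∀ q : MetricGraph G, q.coord e < p.coord e → ∀ A', IsGeodesic A' q p →
          (q.OnEdge e w ∧ realDist q p = p.coord e - q.coord e ∧
            realDist (vert G w) q = q.coord e) ∨
          realDist q p = realDist (vert G w) q + p.coord e := by
        intro q hq A' hA'
        by_cases hq0 : q.coord e = 0
        · right
          have hwA : vert G w ∈ A' := by
            by_contra hwA
            obtain ⟨b, hbw, hb⟩ :=
              (q.eq_vert_or_exists_ne w).resolve_left fun h => hwA (h ▸ hA'.left_mem)
            have := eq_of_reachable_isolate hstar (reachable_of_isPreconnected
              hA'.isPreconnected hwA hA'.left_mem hA'.right_mem hb hpe hbw hew)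
            exact hb (this ▸ hq0)
          have h3 := hA'.realDist_add hwA
          rw [hpE.symm.realDist_vert] at h3
          rw [realDist_comm (vert G w)]
          linarith [hpE.2]
        · left
          have hqE := onEdge_of_star hw hstar hew hq0
          refine ⟨hqE, ?_, ?_⟩
          · rw [hqE.realDist_eq hpE, abs_of_neg (by linarith)]
            ring
          · rw [hqE.symm.realDist_vert]
            linarith [hqE.2]
      obtain ⟨A₁, A₂, -, -, hA1, hA2⟩ := hA.exists_split hp
      have h3 := realDist_triangle x (vert G w) y
      rw [realDist_comm x (vert G w)] at h3
      rw [realDist_comm p y] at hadd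
      rcases key x h1 A₁ hA1 with ⟨hxE, h4, h5⟩ | h4 <;>
        rcases key y h2 A₂ hA2.symm with ⟨hyE, h6, h7⟩ | h6
      · rw [hxE.realDist_eq hyE] at hadd
        rcases abs_cases (x.coord e - y.coord e) with ⟨h8, -⟩ | ⟨h8, -⟩ <;> linarith
      · linarith
      · linarith
      · linarith
    · have hxE := onEdge_of_star hw hstar hew (hp0.trans h1).ne'
      have hyE := onEdge_of_star hw hstar hew (hp0.trans h2).ne'
      rw [hxE.realDist_eq hyE, hxE.realDist_eq hpE, hpE.realDist_eq hyE,
        abs_of_pos (by linarith), abs_of_neg (by linarith)] at hadd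
      rcases abs_cases (x.coord e - y.coord e) with ⟨h8, -⟩ | ⟨h8, -⟩ <;> linarith

theorem hyperbolicityConstant_of_star {w : V} (hw : ∀ v, v ≠ w → G.Adj w v)
    (hstar : ∀ a b, a ≠ w → b ≠ w → ¬ G.Adj a b) :
    hyperbolicityConstant (MetricGraph G) = 0 := by
  refine le_antisymm (hyperbolicityConstant_le fun A B C x y z p hA hB hC hp => ?_) zero_le
  rw [Metric.infEDist_zero_of_mem (mem_sides_of_star hw hstar hA (isPreconnected_sides hB hC)
    (Or.inr hC.right_mem) (Or.inl hB.left_mem) hp)]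

end Star

end MetricGraph

/-! ### Points at distance greater than two. -/

namespace MetricGraph

open GromovHyperbolic

section LongDistance

variable {V : Type*} {G : SimpleGraph V} [hG : Fact (∀ u v, G.edist u v ≤ 2)]

/-- Points at distance more than two yield a vertex and an edge far from it. -/
theorem exists_far_edge {x y : MetricGraph G} (h : 2 < realDist x y) :
    ∃ b u v, G.Adj u v ∧ vertexDist G b u = 2 ∧ vertexDist G b v = 2 ∧
      ((x.coord b ≠ 0 ∧ y.coord u ≠ 0) ∨ (y.coord b ≠ 0 ∧ x.coord u ≠ 0)) := by
  have far : ∀ c g, 1 < vertexDist G c g → vertexDist G c g = 2 := by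
    intro c g h
    rcases vertexDist_cases (G := G) c g with ⟨-, h6⟩ | ⟨-, h6⟩ | ⟨-, -, h6⟩
    · linarith
    · linarith
    · exact h6
  have near : ∀ c g, vertexDist G c g = 2 ∨ vertexDist G c g ≤ 1 := by
    intro c g
    rcases le_or_gt (vertexDist G c g) 1 with h | h
    · exact Or.inr h
    · exact Or.inl (far c g h)
  have vertex : ∀ (a : V) (y : MetricGraph G), 2 < realDist (vert G a) y →
      ∃ u v, G.Adj u v ∧ vertexDist G a u = 2 ∧ vertexDist G a v = 2 ∧ y.coord u ≠ 0 := by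
    intro a y h
    rcases y.eq_vert_or_onEdge with ⟨c, rfl⟩ | ⟨u, v, huv, hu, hv⟩
    · rw [realDist_vert_vert] at h
      linarith [vertexDist_le_two (G := G) a c]
    · have h1 := realDist_vert_le (a := a) hu.ne'
      have h2 := realDist_vert_le (a := a) hv.ne'
      exact ⟨u, v, huv.1, far a u (by linarith), far a v (by linarith), hu.ne'⟩
  rcases x.eq_vert_or_onEdge with ⟨a, rfl⟩ | ⟨a, b, hab, ha, hb⟩
  · obtain ⟨u, v, h1, h2, h3, h4⟩ := vertex a y h
    exact ⟨a, u, v, h1, h2, h3, Or.inl ⟨by simp, h4⟩⟩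
  rcases y.eq_vert_or_onEdge with ⟨u, rfl⟩ | ⟨u, v, huv, hu, hv⟩
  · rw [realDist_comm] at h
    obtain ⟨a, b, h1, h2, h3, h4⟩ := vertex u x h
    exact ⟨u, a, b, h1, h2, h3, Or.inr ⟨by simp, h4⟩⟩
  have h1 := realDist_le_of_coord ha.ne' hu.ne'
  have h2 := realDist_le_of_coord ha.ne' hv.ne'
  have h3 := realDist_le_of_coord hb.ne' hu.ne'
  have h4 := realDist_le_of_coord hb.ne' hv.ne'
  have h5 := hab.2
  have h6 := huv.2
  -- Routes through opposite pairs of ends have total length 2 + d(a, u) + d(b, v) > 4, so one of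
  -- the two distances is 2; likewise for the other pairing. Any choice of one from each pairing
  -- shares a vertex, which is then far from a whole edge.
  have c1 : vertexDist G a u = 2 ∨ vertexDist G b v = 2 := by
    rcases near a u with h | h
    · exact Or.inl h
    · exact Or.inr (far b v (by linarith))
  have c2 : vertexDist G a v = 2 ∨ vertexDist G b u = 2 := by
    rcases near a v with h | h
    · exact Or.inl h
    · exact Or.inr (far b u (by linarith))
  rcases c1 with h7 | h7 <;> rcases c2 with h8 | h8
  · exact ⟨a, u, v, huv.1, h7, h8, Or.inl ⟨ha.ne', hu.ne'⟩⟩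
  · refine ⟨u, a, b, hab.1, ?_, ?_, Or.inr ⟨hu.ne', ha.ne'⟩⟩ <;> rw [vertexDist_comm] <;> assumption
  · refine ⟨v, a, b, hab.1, ?_, ?_, Or.inr ⟨hv.ne', ha.ne'⟩⟩ <;> rw [vertexDist_comm] <;> assumption
  · exact ⟨b, u, v, huv.1, h8, h7, Or.inl ⟨hb.ne', hu.ne'⟩⟩

theorem ne_and_not_adj_of_vertexDist {c g : V} (h : vertexDist G c g = 2) :
    c ≠ g ∧ ¬ G.Adj c g := by
  rcases vertexDist_cases (G := G) c g with ⟨-, h6⟩ | ⟨-, h6⟩ | ⟨h1, h2, -⟩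
  · rw [h6] at h
    norm_num at h
  · rw [h6] at h
    norm_num at h
  · exact ⟨h1, h2⟩

end LongDistance

/-! ### Joins: the gap between 1 and 5/4, and the classification. -/

variable {V : Type*} {G : SimpleGraph V}

/-- A walk to `b` from an edge far from `b` enters the neighbourhood of `b` from an edge far
from `b`. -/
theorem exists_path_of_walk {w b c : V} (p : (isolate G w).Walk c b) : ∀ d, G.Adj c d → c ≠ b →
    ¬ G.Adj b c → d ≠ b → ¬ G.Adj b d → ∃ q v u, q ≠ w ∧ G.Adj b q ∧ G.Adj q v ∧ G.Adj v u ∧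
      b ≠ v ∧ ¬ G.Adj b v ∧ b ≠ u ∧ ¬ G.Adj b u := by
  induction p with
  | nil => exact fun d _ h => absurd rfl h
  | @cons c c' b h p ih =>
    intro d hcd hcb hbc hdb hbd
    -- The invariant is an edge cd, with d the vertex preceding c, both not adjacent to b and
    -- different from it. At the first c' adjacent to b, the answer is c', c, d; c' differs from w
    -- because edges of `isolate G w` do.
    by_cases hc' : G.Adj b c'
    · exact ⟨c', c, d, h.2.2, hc', h.1.symm, hcd, hcb.symm, hbc, hdb.symm, hbd⟩
    · exact ih c h.1.symm (fun h' => hbc (h' ▸ h.1.symm)) hc' hcb hbc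

/-- The vertex set of `G` has two parts, the vertices of which are joined by all possible edges. -/
def IsJoinOf (G : SimpleGraph V) (S : Set V) : Prop :=
  S.Nonempty ∧ Sᶜ.Nonempty ∧ ∀ a ∈ S, ∀ b ∉ S, G.Adj a b

theorem IsJoinOf.compl {S : Set V} (h : IsJoinOf G S) : IsJoinOf G Sᶜ :=
  ⟨h.2.1, by rw [compl_compl]; exact h.1, fun a ha b hb => (h.2.2 b (not_not.1 hb) a ha).symm⟩

theorem IsJoinOf.edist_le_two {S : Set V} (h : IsJoinOf G S) (u v : V) : G.edist u v ≤ 2 := by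
  obtain ⟨⟨s, hs⟩, ⟨t, ht⟩, hadj⟩ := h
  have one : ∀ u v, G.Adj u v → G.edist u v ≤ 2 := fun u v h => by
    rw [SimpleGraph.edist_eq_one_iff_adj.2 h]
    exact one_le_two
  have two : ∀ u v w, G.Adj u v → G.Adj v w → G.edist u w ≤ 2 := fun u v w h1 h2 => by
    refine (SimpleGraph.edist_triangle (v := v)).trans (le_of_eq ?_)
    rw [SimpleGraph.edist_eq_one_iff_adj.2 h1, SimpleGraph.edist_eq_one_iff_adj.2 h2]
    exact one_add_one_eq_two
  by_cases hu : u ∈ S <;> by_cases hv : v ∈ S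
  · exact two u t v (hadj u hu t ht) (hadj v hv t ht).symm
  · exact one u v (hadj u hu v hv)
  · exact one u v (hadj v hv u hu).symm
  · exact two u s v (hadj s hs u hu).symm (hadj s hs v hv)

theorem IsJoinOf.mem_iff {S : Set V} (h : IsJoinOf G S) {a b : V} (hab : ¬ G.Adj a b) :
    a ∈ S ↔ b ∈ S := by
  constructor <;> intro h1 <;> by_contra h2
  · exact hab (h.2.2 a h1 b h2)
  · exact hab (h.2.2 b h1 a h2).symm

variable [hG : Fact (∀ u v, G.edist u v ≤ 2)]

/-- Vertices not adjacent to b are in the part of b, so every vertex of the other part is joined to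
b, u and v. Two of them complete a 5-cycle; if there is only one, it is an apex, and the walk
provided by `hconn` gives the other neighbour of b. -/
theorem five_quarters_le_of_far_edge {S : Set V} (hS : IsJoinOf G S) {b u v : V}
    (huv : G.Adj u v) (hbu : b ≠ u ∧ ¬ G.Adj b u) (hbv : b ≠ v ∧ ¬ G.Adj b v)
    (hconn : ∀ w, (∀ v, v ≠ w → G.Adj w v) → (isolate G w).Reachable b u) :
    ENNReal.ofReal (5 / 4) ≤ hyperbolicityConstant (MetricGraph G) := by
  wlog hb : b ∈ S generalizing S
  · exact this hS.compl hb
  have hu := (hS.mem_iff hbu.2).1 hb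
  have hv := (hS.mem_iff hbv.2).1 hb
  obtain ⟨w, hw⟩ := hS.2.1
  by_cases hq : ∃ q ∉ S, q ≠ w
  · obtain ⟨q, hq, hqw⟩ := hq
    exact five_quarters_le_of_five_cycle (hS.2.2 b hb q hq) (hS.2.2 v hv q hq).symm huv.symm
      (hS.2.2 u hu w hw) (hS.2.2 b hb w hw).symm hbv.1 hbv.2 hbu.1 hbu.2 hqw
  · push Not at hq
    have hapex : ∀ v, v ≠ w → G.Adj w v := fun v hvw =>
      (hS.2.2 v (by_contra fun h => hvw (hq v h)) w hw).symm
    obtain ⟨p⟩ := (hconn w hapex).symm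
    obtain ⟨q, v', u', hqw, h1, h2, h3, h4, h5, h6, h7⟩ :=
      exists_path_of_walk p v huv hbu.1.symm hbu.2 hbv.1.symm hbv.2
    have hu' := (hS.mem_iff h7).1 hb
    exact five_quarters_le_of_five_cycle h1 h2 h3 (hS.2.2 u' hu' w hw) (hS.2.2 b hb w hw).symm
      h4 h5 h6 h7 hqw

/-- The triangle that is not 1-thin is used twice: its long side gives the far edge, and its distant
sides give the connection outside any apex. -/
theorem five_quarters_le_of_one_lt {S : Set V} (hS : IsJoinOf G S)
    (h : ENNReal.ofReal 1 < hyperbolicityConstant (MetricGraph G)) :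
    ENNReal.ofReal (5 / 4) ≤ hyperbolicityConstant (MetricGraph G) := by
  obtain ⟨A, B, C, x, y, z, p, hA, hB, hC, hp, hlt⟩ := exists_of_lt_hyperbolicityConstant h
  have far : ∀ q ∈ B ∪ C, 1 < realDist p q := fun q hq => lt_realDist_of_lt_infEDist hlt hq
  have hpy := far y (Or.inl hB.left_mem)
  have hpx := far x (Or.inr hC.right_mem)
  rw [realDist_comm] at hpx
  have hadd := hA.realDist_add hp
  obtain ⟨b, u, v, huv, hbu, hbv, hsupp⟩ := exists_far_edge (x := x) (y := y) (by linarith)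
  replace hbu := ne_and_not_adj_of_vertexDist hbu
  replace hbv := ne_and_not_adj_of_vertexDist hbv
  refine five_quarters_le_of_far_edge hS huv hbu hbv fun w hw => ?_
  have hbw : b ≠ w := fun h => hbu.2 (h ▸ hw u fun h' => hbu.1 (h.trans h'.symm))
  have huw : u ≠ w := fun h => hbu.2 (h ▸ (hw b hbw).symm)
  have far' : ∀ q ∈ B ∪ C, 3 / 4 < realDist p q := fun q hq => by linarith [far q hq]
  rcases hsupp with ⟨h1, h2⟩ | ⟨h1, h2⟩
  · exact reachable_of_far_sides hw hA hB hC hp far' h1 h2 hbw huw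
  · exact (reachable_of_far_sides hw hA hB hC hp far' h2 h1 huw hbw).symm

/-- A join contains a four-cycle, or it is a windmill. -/
theorem IsJoinOf.one_le_or_exists_apex {S : Set V} (hS : IsJoinOf G S) :
    ENNReal.ofReal 1 ≤ hyperbolicityConstant (MetricGraph G) ∨
      ∃ w, (∀ v, v ≠ w → G.Adj w v) ∧
        ∀ a b c, a ≠ w → b ≠ w → c ≠ w → a ≠ c → G.Adj a b → ¬ G.Adj b c := by
  by_contra! hc
  have hapex : ∃ w, ∀ v, v ≠ w → G.Adj w v := by
    obtain ⟨⟨s, hs⟩, ⟨t, ht⟩, hadj⟩ := hS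
    -- Two vertices in each part form an alternating 4-cycle; otherwise one part is a single vertex,
    -- which is an apex. A path a b c outside the apex w would then close the 4-cycle w a b c.
    by_cases h1 : ∃ s' ∈ S, s' ≠ s
    · by_cases h2 : ∃ t' ∉ S, t' ≠ t
      · obtain ⟨s', hs', hss⟩ := h1
        obtain ⟨t', ht', htt⟩ := h2
        exact absurd (one_le_of_four_cycle (hadj s hs t ht) (hadj s' hs' t ht).symm
          (hadj s' hs' t' ht') (hadj s hs t' ht').symm hss.symm htt.symm) (not_le.2 hc.1)
      · push Not at h2
        exact ⟨t, fun v hv => (hadj v (by_contra fun h => hv (h2 v h)) t ht).symm⟩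
    · push Not at h1
      exact ⟨s, fun v hv => hadj s hs v fun h => hv (h1 v h)⟩
  obtain ⟨w, hw⟩ := hapex
  obtain ⟨a, b, c, ha, hb, hcw, hac, hab, hbc⟩ := hc.2 w hw
  exact absurd (one_le_of_four_cycle (hw a ha) hab hbc (hw c hcw).symm hb.symm hac) (not_le.2 hc.1)

theorem IsJoinOf.hyperbolicityConstant_mem {S : Set V} (hS : IsJoinOf G S) :
    hyperbolicityConstant (MetricGraph G) ∈ ({ENNReal.ofReal 0, ENNReal.ofReal (3 / 4),
      ENNReal.ofReal 1, ENNReal.ofReal (5 / 4), ENNReal.ofReal (3 / 2)} : Set ℝ≥0∞) := by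
  simp only [Set.mem_insert_iff, Set.mem_singleton_iff]
  rcases lt_or_ge (ENNReal.ofReal (5 / 4)) (hyperbolicityConstant (MetricGraph G)) with h1 | h1
  · exact Or.inr (Or.inr (Or.inr (Or.inr (le_antisymm (hyperbolicityConstant_le
      fun A B C x y z p => infEDist_sides_le) (three_halves_le_of_five_quarters_lt h1)))))
  rcases lt_or_ge (ENNReal.ofReal 1) (hyperbolicityConstant (MetricGraph G)) with h2 | h2
  · exact Or.inr (Or.inr (Or.inr (Or.inl (le_antisymm h1 (five_quarters_le_of_one_lt hS h2)))))
  rcases hS.one_le_or_exists_apex with h3 | ⟨w, hw, hm⟩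
  · exact Or.inr (Or.inr (Or.inl (le_antisymm h2 h3)))
  by_cases h4 : ∃ a b, a ≠ w ∧ b ≠ w ∧ G.Adj a b
  · obtain ⟨a, b, ha, hb, hab⟩ := h4
    exact Or.inr (Or.inl (le_antisymm (hyperbolicityConstant_le_of_windmill hw hm)
      (three_quarters_le_of_triangle (hw a ha) hab (hw b hb).symm)))
  · push Not at h4
    left
    rw [hyperbolicityConstant_of_star hw h4, ENNReal.ofReal_zero]

theorem isHyperbolic_of_edist_le_two : IsHyperbolic (MetricGraph G) :=
  ⟨Real.toNNReal (3 / 2), fun _ _ _ hT =>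
    isThin_of_forall (fun _ _ _ _ _ _ _ => infEDist_sides_le) hT⟩

end MetricGraph

theorem SimpleGraph.isJoinOf_graphJoin {V W : Type*} [Nonempty V] [Nonempty W]
    (G₁ : SimpleGraph V) (G₂ : SimpleGraph W) :
    MetricGraph.IsJoinOf (G₁.graphJoin G₂) (Set.range Sum.inl) := by
  refine ⟨Set.range_nonempty _, ?_, ?_⟩
  · obtain ⟨w⟩ := ‹Nonempty W›
    exact ⟨Sum.inr w, by simp⟩
  · rintro _ ⟨v, rfl⟩ (v' | w) hw
    · exact absurd ⟨v', rfl⟩ hw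
    · exact Or.inr (by simp)

theorem propositionr {V W : Type*} [Nonempty V] [Nonempty W]
    (G₁ : SimpleGraph V) (G₂ : SimpleGraph W) :
    GromovHyperbolic.IsHyperbolic (MetricGraph (G₁.graphJoin G₂)) ∧
      GromovHyperbolic.hyperbolicityConstant (MetricGraph (G₁.graphJoin G₂)) ∈
        ({0, 3 / 4, 1, 5 / 4, 3 / 2} : Set ℝ≥0∞) := by
  have hS := SimpleGraph.isJoinOf_graphJoin G₁ G₂
  have : Fact (∀ u v, (G₁.graphJoin G₂).edist u v ≤ 2) := ⟨hS.edist_le_two⟩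
  refine ⟨MetricGraph.isHyperbolic_of_edist_le_two, ?_⟩
  -- The values were found as `ENNReal.ofReal` of real fractions, while the statement divides in
  -- `ℝ≥0∞`.
  have key : ∀ m n : ℕ, 0 < n → ENNReal.ofReal (m / n) = m / n := fun m n hn => by
    rw [ENNReal.ofReal_div_of_pos (by exact_mod_cast hn), ENNReal.ofReal_natCast,
      ENNReal.ofReal_natCast]
  have h1 := key 3 4 (by norm_num)
  have h2 := key 5 4 (by norm_num)
  have h3 := key 3 2 (by norm_num)
  push_cast at h1 h2 h3
  have h := hS.hyperbolicityConstant_mem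
  rwa [h1, h2, h3, ENNReal.ofReal_zero, ENNReal.ofReal_one] at h
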